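/- Let $V$ be a finite-dimensional real vector space with inner product $\langle\cdot,\cdot\rangle$, let $\Phi\subset V$ be a reduced (crystallographic) root system spanning $V$, with fundamental system $\Delta=\{\alpha_1,\dots,\alpha_r\}$, positive and negative roots $\Phi^{\pm}$, Weyl group $W$, coroots $\alpha^\vee=2\alpha/\langle\alpha,\alpha\rangle$, fundamental weights $\lambda_j$ ($\langle\lambda_i,\alpha_j^\vee\rangle=\delta_{ij}$), $\rho=\frac12\sum_{\alpha\in\Phi^+}\alpha$ and $\operatorname{ht}\alpha^\vee=\langle\rho,\alpha^\vee\rangle$. Fix $1\le p\le r$ and put $\Delta_p=\Delta\setminus\{\alpha_p\}$, $\Phi_p^+=\{\alpha\in\Phi^+ : \langle\lambda_p,\alpha\rangle=0\}$, $\rho_p=\frac12\sum_{\alpha\in\Phi_p^+}\alpha$, $c_p=2\langle\lambda_p-\rho_p,\alpha_p^\vee\rangle$, and $$\mathfrak W_p=\{w\in W : \Delta_p\subset w^{-1}(\Delta\cup\Phi^-)\},\qquad \mathfrak W_p^\ddagger=\{w\in\mathfrak W_p : (\Phi^+\setminus\Phi_p^+)\cap w^{-1}\Phi^-=\emptyset\}.$$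 Let $\xi(s)=s(s-1)\pi^{-s/2}\Gamma(s/2)\zeta(s)$ (an entire function), and for $w\in W$ let $$X_{p,w}(s)=\prod_{\alpha\in\Phi^+\setminus\Phi_p^+}\xi\bigl(\langle\lambda_p,\alpha^\vee\rangle s+\operatorname{ht}\alpha^\vee+\delta_{\alpha,w}\bigr),\qquad \delta_{\alpha,w}=\begin{cases}1&\alpha\in w^{-1}\Phi^+,\\0&\alpha\in w^{-1}\Phi^-,\end{cases}$$ and $X_p^\ddagger=X_{p,\mathrm{id}}$. Then for every $w\in\mathfrak W_p\setminus\mathfrak W_p^\ddagger$ the meromorphic function $X_{p,w}/X_p^\ddagger$ is holomorphic (after removing removable singularities) at every point of the closed half-plane $\operatorname{Re}(s)\ge -c_p/2$, and there $$\left|\frac{X_{p,w}(s)}{X_p^\ddagger(s)}\right|<1\ \text{ for }\operatorname{Re}(s)>-\frac{c_p}{2},\qquad \left|\frac{X_{p,w}(s)}{X_p^\ddagger(s)}\right|\le1\ \text{ for }\operatorname{Re}(s)=-\frac{c_p}{2}.$$ -/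

import Mathlib

noncomputable section

namespace WengZeta

/-- The entire function `ξ(s) = s (s - 1) π^(-s/2) Γ(s/2) ζ(s)`. Mathlib's `completedRiemannZeta₀` is
the entire function `Λ₀(s) = π^(-s/2) Γ(s/2) ζ(s) + 1/s + 1/(1-s)`, whence the formula below, which
also gives the right values at `s = 0, 1` (and at the poles of `Γ(s/2)`). -/
def xi (s : ℂ) : ℂ := s * (s - 1) * completedRiemannZeta₀ s + 1

theorem xi_eq_completedRiemannZeta {s : ℂ} (h0 : s ≠ 0) (h1 : s ≠ 1) :
    xi s = s * (s - 1) * completedRiemannZeta s := by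
  have h1' : 1 - s ≠ 0 := sub_ne_zero.mpr (Ne.symm h1)
  rw [completedRiemannZeta_eq, xi]
  field_simp
  ring

theorem xi_eq {s : ℂ} (h1 : s ≠ 1) (hG : Complex.Gamma (s / 2) ≠ 0) (h0 : s ≠ 0) :
    xi s = s * (s - 1) * ((Real.pi : ℂ) ^ (-s / 2) * Complex.Gamma (s / 2) * riemannZeta s) := by
  rw [xi_eq_completedRiemannZeta h0 h1, riemannZeta_def_of_ne_zero h0, Complex.Gammaℝ_def]
  have hpi : (Real.pi : ℂ) ^ (-s / 2) ≠ 0 := by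
    simp [Complex.cpow_eq_zero_iff, Real.pi_ne_zero]
  field_simp

theorem differentiable_xi : Differentiable ℂ xi := by
  unfold xi
  have := differentiable_completedZeta₀
  fun_prop

variable {ι V N : Type*} [AddCommGroup V] [Module ℝ V] [AddCommGroup N] [Module ℝ N]
  {P : RootPairing ι ℝ V N}

/-- The fundamental weight `λ_p ∈ V`, characterised by `⟨λ_p, α_j^∨⟩ = δ_{pj}` for the simple
coroots `α_j^∨`. -/
def fundamentalWeight [P.IsRootSystem] (b : P.Base) (p : b.support) : V :=
  P.toLinearMap.toPerfPair.symm (b.toCoweightBasis.coord p)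

open Classical in
theorem fundamentalWeight_coroot [P.IsRootSystem] (b : P.Base) (p j : b.support) :
    P.toLinearMap (fundamentalWeight b p) (P.coroot j) = if j = p then 1 else 0 := by
  have h : P.toLinearMap (fundamentalWeight b p) = b.toCoweightBasis.coord p :=
    P.toLinearMap.toPerfPair.apply_symm_apply _
  rw [h, Module.Basis.coord_apply, RootPairing.Base.toCoweightBasis_repr_coroot,
    Finsupp.single_apply]

section

variable [Fintype ι]

open Classical in
/-- The set `Φ⁺` of (indices of) positive roots. A root is negative iff it is not positive. -/
def posRoots (b : P.Base) : Finset ι := {i | b.IsPos i}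

/-- The Weyl vector `ρ`, half the sum of the positive roots. -/
def weylVector (b : P.Base) : V := (1 / 2 : ℝ) • ∑ i ∈ posRoots b, P.root i

/-- The height `ht α^∨ = ⟨ρ, α^∨⟩`. -/
def coheight (b : P.Base) (i : ι) : ℝ := P.toLinearMap (weylVector b) (P.coroot i)

variable [P.IsRootSystem] (b : P.Base) (p : b.support)

/-- The number `⟨λ_p, α^∨⟩`. -/
def level (i : ι) : ℝ := P.toLinearMap (fundamentalWeight b p) (P.coroot i)

open Classical in
/-- The set `Φ_p⁺` of positive roots `α` normal to `λ_p`, that is, with `⟨λ_p, α^∨⟩ = 0`. -/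
def leviPosRoots : Finset ι := {i ∈ posRoots b | level b p i = 0}

/-- `ρ_p`, half the sum of the elements of `Φ_p⁺`. -/
def leviWeylVector : V := (1 / 2 : ℝ) • ∑ i ∈ leviPosRoots b p, P.root i

/-- `c_p = 2 ⟨λ_p - ρ_p, α_p^∨⟩`. -/
def cConst : ℝ :=
  2 * P.toLinearMap (fundamentalWeight b p - leviWeylVector b p) (P.coroot p)

open Classical in
/-- The set `Φ⁺ \ Φ_p⁺`. -/
def nilPosRoots : Finset ι := posRoots b \ leviPosRoots b p

/-- The set `𝔚_p` of the Weyl group elements `w` with `Δ_p ⊂ w⁻¹(Δ ∪ Φ⁻)`, where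
`Δ_p = Δ \ {α_p}`. -/
def admissible : Set P.weylGroup :=
  {w | ∀ j ∈ b.support, j ≠ (p : ι) → w • j ∈ b.support ∨ w • j ∉ posRoots b}

open Classical in
/-- `δ_{α,w}`, equal to `1` if `α ∈ w⁻¹Φ⁺` and to `0` if `α ∈ w⁻¹Φ⁻`. -/
def delta (w : P.weylGroup) (i : ι) : ℕ := if w • i ∈ posRoots b then 1 else 0

/-- `X_{p,w}(s)`, the product of `ξ(⟨λ_p, α^∨⟩ s + ht α^∨ + δ_{α,w})` over `α ∈ Φ⁺ \ Φ_p⁺`. -/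
def X (w : P.weylGroup) (s : ℂ) : ℂ :=
  ∏ i ∈ nilPosRoots b p, xi ((level b p i : ℂ) * s + (coheight b i : ℂ) + (delta b w i : ℂ))

open Classical in
/-- `l_p(w)`, the cardinality of `(Φ⁺ \ Φ_p⁺) ∩ w⁻¹Φ⁻`. -/
def len (w : P.weylGroup) : ℕ := {i ∈ nilPosRoots b p | w • i ∉ posRoots b}.card

/-- The set `𝔚_p^‡` of the `w ∈ 𝔚_p` with `l_p(w) = 0`. -/
def admissibleDagger : Set P.weylGroup := {w ∈ admissible b p | len b p w = 0}

/-- The dominant term `X_p^‡ = X_{p,id}`. -/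
def XDagger : ℂ → ℂ := X b p 1

/-- The quotient `X_{p,w} / X_p^‡` as a meromorphic function on `ℂ`: where it has a removable
singularity (a common zero of numerator and denominator) the value is the limit. -/
def ratio (w : P.weylGroup) : ℂ → ℂ :=
  toMeromorphicNFOn (fun s => X b p w s / XDagger b p s) Set.univ

theorem differentiable_X (w : P.weylGroup) : Differentiable ℂ (X b p w) := by
  have h := differentiable_xi
  unfold X
  fun_prop

theorem meromorphicOn_quotient (w : P.weylGroup) :
    MeromorphicOn (fun s => X b p w s / XDagger b p s) Set.univ := fun s _ =>
  ((differentiable_X b p w).analyticAt s).meromorphicAt.div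
    ((differentiable_X b p 1).analyticAt s).meromorphicAt

theorem ratio_eq (w : P.weylGroup) {s : ℂ} (hs : XDagger b p s ≠ 0) :
    ratio b p w s = X b p w s / XDagger b p s := by
  have h : AnalyticAt ℂ (fun s => X b p w s / XDagger b p s) s :=
    ((differentiable_X b p w).analyticAt s).div ((differentiable_X b p 1).analyticAt s) hs
  rw [ratio, toMeromorphicNFOn_eq_toMeromorphicNFAt (meromorphicOn_quotient b p w)
    (Set.mem_univ s), toMeromorphicNFAt_eq_self.mpr h.meromorphicNFAt]

end

end WengZeta

end

noncomputable section

namespace WengZeta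

open Complex Filter Topology Set MeasureTheory Asymptotics

/-! ### The Gamma function -/

/-! Put `t = s + c_p/2`. Since `ρ = ρ_p + (c_p/2) λ_p` (`weylVector_eq`), the argument `⟨λ_p, α^∨⟩ s
+ ht α^∨` becomes `k t + a/2` with `k = ⟨λ_p, α^∨⟩` and the integer `a = 2⟨ρ_p, α^∨⟩`, and the
half-plane becomes `Re t ≥ 0`. Roots kept positive by `w` cancel in the quotient. What remains is
the product of `ξ(kt + a/2) / ξ(kt + a/2 + 1)` over the roots outside `Φ_p⁺` that `w` makes
negative.

A single factor with `a < 0` is not under control, because its denominator may enter the critical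
strip. The factors with equal `k` are therefore grouped. A string of weights `-m, -m + 2, …, m`
telescopes to `ξ(kt - m/2) / ξ(kt + m/2 + 1)`, which is bounded by `1` thanks to `|ξ(z + b)| ≤ |ξ(z
+ 1 - b)|` for `b ≤ 0`, `Re z ≥ 0` (`norm_xi_add_le`, strict in `norm_xi_add_lt`). That inequality
is Phragmén–Lindelöf for a quotient of modulus `1` on the imaginary axis. Factors with `a ≥ 0` are
covered by its case `b = 0`.

It remains to split the weights `a` into such strings and nonnegative leftovers
(`IsLefschetz.dominatedAt`). The weights are those of the principal `𝔰𝔩₂` of the Levi subalgebra of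
`Δ_p`, acting in the Lie algebra of the dual root system. For `w ∈ 𝔚_p` the root vectors of given
level with `wα < 0` span a space stable under `e`. Injectivity of `e` and of `e ^ m` on negative
weight spaces then gives the required inequalities between multiplicities
(`isLefschetz_leviDegree`). -/

/-- The quotient `Γ(w)Γ(d)/Γ(w + d)` is a beta integral, and taking absolute values inside the
integral replaces `w` by `Re w`. -/
theorem norm_Gamma_mul_Gamma_le {w : ℂ} (hw : 0 < w.re) {d : ℝ} (hd : 0 ≤ d) :
    ‖Gamma w‖ * Real.Gamma (w.re + d) ≤ Real.Gamma w.re * ‖Gamma (w + d)‖ := by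
  rcases hd.eq_or_lt with rfl | hd
  · simp [mul_comm]
  have hd' : 0 < (d : ℂ).re := by simpa
  have h1 := Gamma_mul_Gamma_eq_betaIntegral hw hd'
  have h2 := Gamma_mul_Gamma_eq_betaIntegral (s := (w.re : ℂ)) (by simpa) hd'
  have hB : ‖betaIntegral w d‖ ≤ ‖betaIntegral (w.re : ℂ) d‖ := by
    have e : betaIntegral (w.re : ℂ) d
        = ((∫ x in (0 : ℝ)..1, x ^ (w.re - 1) * (1 - x) ^ (d - 1) : ℝ) : ℂ) := by
      rw [betaIntegral, ← intervalIntegral.integral_ofReal]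
      refine intervalIntegral.integral_congr fun x hx => ?_
      rw [uIcc_of_le zero_le_one] at hx
      rw [ofReal_mul, ofReal_cpow hx.1, ofReal_cpow (by linarith [hx.2])]
      push_cast
      rfl
    rw [e, norm_real, betaIntegral]
    refine (intervalIntegral.norm_integral_le_integral_norm zero_le_one).trans ?_
    refine le_trans (le_of_eq ?_) (le_abs_self _)
    refine intervalIntegral.integral_congr_ae ?_
    -- The formula for the norm of a power needs a positive base, which `1 - x` is not at the
    -- endpoint.
    have h0 : ∀ᵐ x : ℝ, x ≠ 1 := by
      simp [ae_iff, measure_singleton]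
    filter_upwards [h0] with x hx1 hx
    rw [uIoc_of_le zero_le_one] at hx
    have hx2 : 0 < 1 - x := by
      have := lt_of_le_of_ne hx.2 hx1
      linarith
    rw [norm_mul, norm_cpow_eq_rpow_re_of_pos hx.1]
    have : (1 - (x : ℂ)) = ((1 - x : ℝ) : ℂ) := by push_cast; rfl
    rw [this, norm_cpow_eq_rpow_re_of_pos hx2]
    simp
  have hdp : 0 < Real.Gamma d := Real.Gamma_pos_of_pos hd
  have hxp : 0 < Real.Gamma w.re := Real.Gamma_pos_of_pos hw
  have hsp : 0 < Real.Gamma (w.re + d) := Real.Gamma_pos_of_pos (by linarith)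
  have e2 : (w.re : ℂ) + d = ((w.re + d : ℝ) : ℂ) := by push_cast; rfl
  rw [e2] at h2
  have n1 := congrArg norm h1
  have n2 := congrArg norm h2
  simp only [norm_mul, Complex.Gamma_ofReal, norm_real, Real.norm_of_nonneg hdp.le,
    Real.norm_of_nonneg hxp.le, Real.norm_of_nonneg hsp.le] at n1 n2
  have key : ‖Gamma w‖ * Real.Gamma (w.re + d) * Real.Gamma d ≤
      Real.Gamma w.re * ‖Gamma (w + d)‖ * Real.Gamma d := by
    calc _ = ‖Gamma (w + d)‖ * ‖betaIntegral w d‖ * Real.Gamma (w.re + d) := by rw [← n1]; ring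
      _ ≤ ‖Gamma (w + d)‖ * ‖betaIntegral (w.re : ℂ) d‖ * Real.Gamma (w.re + d) := by gcongr
      _ = ‖Gamma (w + d)‖ * (Real.Gamma w.re * Real.Gamma d) := by rw [n2]; ring
      _ = _ := by ring
  exact le_of_mul_le_mul_right key hdp

/-- On `Re u = 1/2` one has `1 - u = conj u`, so the reflection formula gives `|Γ(u)|² |sin πu| =
π`. The beta integral inequality carries the resulting bound to the right. -/
theorem le_norm_Gamma {w : ℂ} (hw : 1 / 2 ≤ w.re) :
    Real.Gamma w.re * Real.exp (-(Real.pi * |w.im| / 2)) ≤ ‖Gamma w‖ := by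
  set u : ℂ := (1 / 2 : ℝ) + w.im * I with hu
  have hure : u.re = 1 / 2 := by simp [hu]
  have hw' : w = u + ((w.re - 1 / 2 : ℝ) : ℂ) := by
    apply Complex.ext <;> simp [hu]
  have h := norm_Gamma_mul_Gamma_le (w := u) (by rw [hure]; norm_num)
    (d := w.re - 1 / 2) (by linarith)
  rw [← hw', hure, Real.Gamma_one_half_eq] at h
  have hconj : 1 - u = (starRingEnd ℂ) u := by
    apply Complex.ext <;> simp [hu]
    norm_num
  have hsin : ‖Complex.sin (Real.pi * u)‖ ≤ Real.exp (Real.pi * |w.im|) := by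
    rw [Complex.sin]
    have e1 : ‖Complex.exp (-(Real.pi * u) * I)‖ ≤ Real.exp (Real.pi * |w.im|) := by
      rw [norm_exp]
      gcongr
      simp [hu]
      gcongr
      exact le_abs_self _
    have e2 : ‖Complex.exp ((Real.pi * u) * I)‖ ≤ Real.exp (Real.pi * |w.im|) := by
      rw [norm_exp]
      gcongr
      simp [hu]
      rw [← mul_neg]
      gcongr
      exact neg_le_abs _
    rw [norm_div, norm_mul, norm_I, mul_one, Complex.norm_ofNat]
    have := norm_sub_le (Complex.exp (-(Real.pi * u) * I)) (Complex.exp ((Real.pi * u) * I))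
    linarith
  have hΓ : ‖Gamma u‖ ^ 2 * ‖Complex.sin (Real.pi * u)‖ = Real.pi := by
    have := Complex.Gamma_mul_Gamma_one_sub u
    rw [hconj, Gamma_conj] at this
    have hs : Complex.sin (Real.pi * u) ≠ 0 := by
      intro h0
      rw [h0, div_zero, mul_eq_zero, map_eq_zero, or_self] at this
      exact Gamma_ne_zero_of_re_pos (by rw [hure]; norm_num) this
    have n := congrArg norm this
    rw [norm_mul, norm_div, RCLike.norm_conj, norm_real, Real.norm_of_nonneg Real.pi_pos.le,
      eq_div_iff (by simpa using hs)] at n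
    rw [sq]; exact n
  have hlow : Real.sqrt Real.pi * Real.exp (-(Real.pi * |w.im| / 2)) ≤ ‖Gamma u‖ := by
    refine le_of_sq_le_sq ?_ (norm_nonneg _)
    rw [mul_pow, Real.sq_sqrt Real.pi_pos.le, ← Real.exp_nat_mul]
    have e : ((2 : ℕ) : ℝ) * -(Real.pi * |w.im| / 2) = -(Real.pi * |w.im|) := by push_cast; ring
    rw [e, Real.exp_neg, ← div_eq_mul_inv, div_le_iff₀ (Real.exp_pos _)]
    calc Real.pi = ‖Gamma u‖ ^ 2 * ‖Complex.sin (Real.pi * u)‖ := hΓ.symm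
      _ ≤ _ := by gcongr
  have hs : 0 < Real.sqrt Real.pi := Real.sqrt_pos.mpr Real.pi_pos
  have hg : 0 < Real.Gamma w.re := Real.Gamma_pos_of_pos (by linarith)
  rw [add_sub_cancel] at h
  refine le_of_mul_le_mul_left ?_ hs
  calc Real.sqrt Real.pi * (Real.Gamma w.re * Real.exp (-(Real.pi * |w.im| / 2)))
      = (Real.sqrt Real.pi * Real.exp (-(Real.pi * |w.im| / 2))) * Real.Gamma w.re := by ring
    _ ≤ ‖Gamma u‖ * Real.Gamma w.re := by gcongr
    _ ≤ _ := h

theorem half_le_Gamma {b : ℝ} (hb : 1 ≤ b) : 1 / 2 ≤ Real.Gamma b := by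
  rcases le_total 2 b with h | h
  · have := Real.Gamma_strictMonoOn_Ici.monotoneOn (by simp : (2 : ℝ) ∈ Ici 2) h h
    rw [Real.Gamma_two] at this
    linarith
  · have := Real.Gamma_strictMonoOn_Ici.monotoneOn (by simp : (2 : ℝ) ∈ Ici 2)
      (show b + 1 ∈ Ici 2 by simp; linarith) (by linarith)
    rw [Real.Gamma_two, Real.Gamma_add_one (by linarith)] at this
    have hp : 0 < Real.Gamma b := Real.Gamma_pos_of_pos (by linarith)
    nlinarith

/-- `Γ` is not monotone on `[1, 2]`, but there it is at most `2`, while it is at least `1/2` on all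
of `[1, ∞)`. -/
theorem Gamma_le_four_mul_Gamma {a b : ℝ} (ha : 1 ≤ a) (hab : a ≤ b) :
    Real.Gamma a ≤ 4 * Real.Gamma b := by
  have hb := half_le_Gamma (ha.trans hab)
  rcases le_total 2 a with h | h
  · have := Real.Gamma_strictMonoOn_Ici.monotoneOn h (h.trans hab : 2 ≤ b) hab
    linarith
  · have := Real.Gamma_strictMonoOn_Ici.monotoneOn (show a + 1 ∈ Ici 2 by simp; linarith)
      (show (3 : ℝ) ∈ Ici 2 by simp; norm_num) (by linarith)
    have h3 : Real.Gamma 3 = 2 := by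
      have := Real.Gamma_nat_eq_factorial 2
      norm_num [Nat.factorial] at this ⊢
    rw [h3, Real.Gamma_add_one (by linarith)] at this
    have hp : 0 < Real.Gamma a := Real.Gamma_pos_of_pos (by linarith)
    nlinarith

/-! ### Bounds for the zeta function -/

theorem norm_LSeries_le {f : ℕ → ℂ} (hf : ∀ n, ‖f n‖ ≤ 1) {σ : ℝ} (hσ : 1 < σ) {s : ℂ}
    (hs : σ ≤ s.re) : ‖LSeries f s‖ ≤ ∑' n, ‖LSeries.term 1 (σ : ℂ) n‖ := by
  have hsum : Summable fun n => ‖LSeries.term 1 (σ : ℂ) n‖ :=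
    (LSeriesSummable_one_iff.mpr (by simpa : 1 < (σ : ℂ).re)).norm
  refine tsum_of_norm_bounded hsum.hasSum fun n => ?_
  refine (LSeries.norm_term_le_of_re_le_re f (s := (σ : ℂ)) (by simpa) n).trans ?_
  exact LSeries.norm_term_le _ (by simpa using hf n)

theorem exists_norm_riemannZeta_le {σ : ℝ} (hσ : 1 < σ) :
    ∃ C > 0, ∀ s : ℂ, σ ≤ s.re → ‖riemannZeta s‖ ≤ C := by
  refine ⟨(∑' n, ‖LSeries.term 1 (σ : ℂ) n‖) + 1, by positivity, fun s hs => ?_⟩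
  rw [← LSeries_one_eq_riemannZeta (by linarith)]
  linarith [norm_LSeries_le (f := 1) (by simp) hσ hs]

/-- The inverse `1/ζ` is the Dirichlet series of the Möbius function, whose coefficients are bounded
by `1`. -/
theorem exists_le_norm_riemannZeta {σ : ℝ} (hσ : 1 < σ) :
    ∃ c > 0, ∀ s : ℂ, σ ≤ s.re → c ≤ ‖riemannZeta s‖ := by
  set S := (∑' n, ‖LSeries.term 1 (σ : ℂ) n‖) + 1 with hS
  have hSp : 0 < S := by positivity
  refine ⟨S⁻¹, by positivity, fun s hs => ?_⟩
  have hs1 : 1 < s.re := by linarith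
  have h := ArithmeticFunction.LSeries_zeta_mul_Lseries_moebius hs1
  rw [ArithmeticFunction.LSeries_zeta_eq_riemannZeta hs1] at h
  have hm := norm_LSeries_le (f := fun n => (ArithmeticFunction.moebius n : ℂ)) (fun n => by
    have := ArithmeticFunction.abs_moebius_le_one (n := n)
    rw [norm_intCast]
    exact_mod_cast this) hσ hs
  have n := congrArg norm h
  rw [norm_mul, norm_one] at n
  rw [inv_le_iff_one_le_mul₀ hSp, ← n]
  gcongr
  linarith

/-! ### The function `ξ` -/

theorem xi_one_sub (s : ℂ) : xi (1 - s) = xi s := by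
  rw [xi, xi, completedRiemannZeta₀_one_sub]
  ring

theorem xi_eq_of_one_lt_re {s : ℂ} (hs : 1 < s.re) :
    xi s = s * (s - 1) * ((Real.pi : ℂ) ^ (-s / 2) * Gamma (s / 2) * riemannZeta s) :=
  xi_eq (by rintro rfl; simp at hs)
    (Gamma_ne_zero_of_re_pos (by simp only [div_ofNat_re]; linarith))
    (by rintro rfl; simp at hs; linarith)

/-- Conjugating both variable and value gives another entire function, which agrees with `ξ` near
`2`, where the formula by `Γ` and `ζ` is available. -/
theorem xi_conj (s : ℂ) : xi ((starRingEnd ℂ) s) = (starRingEnd ℂ) (xi s) := by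
  have hd : Differentiable ℂ fun z => (starRingEnd ℂ) (xi ((starRingEnd ℂ) z)) := fun z =>
    differentiableAt_conj_conj_iff.mpr (differentiable_xi _)
  have h1 : AnalyticOnNhd ℂ (fun z => (starRingEnd ℂ) (xi ((starRingEnd ℂ) z))) univ :=
    fun z _ => hd.analyticAt z
  have h2 : AnalyticOnNhd ℂ xi univ := fun z _ => differentiable_xi.analyticAt z
  have hev : (fun z => (starRingEnd ℂ) (xi ((starRingEnd ℂ) z))) =ᶠ[𝓝 (2 : ℂ)] xi := by
    have : {z : ℂ | 1 < z.re} ∈ 𝓝 (2 : ℂ) :=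
      (isOpen_lt continuous_const continuous_re).mem_nhds (by simp)
    filter_upwards [this] with z hz
    have hz' : 1 < ((starRingEnd ℂ) z).re := by simpa using hz
    rw [xi_eq_of_one_lt_re hz', xi_eq_of_one_lt_re hz, riemannZeta_conj]
    have e1 : (starRingEnd ℂ) z / 2 = (starRingEnd ℂ) (z / 2) := by rw [map_div₀, map_ofNat]
    have e2 : -(starRingEnd ℂ) z / 2 = (starRingEnd ℂ) (-z / 2) := by rw [map_div₀, map_ofNat, map_neg]
    rw [e1, e2, Gamma_conj]
    have e3 : (Real.pi : ℂ) ^ ((starRingEnd ℂ) (-z / 2))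
        = (starRingEnd ℂ) ((Real.pi : ℂ) ^ (-z / 2)) := by
      rw [cpow_conj _ _ (by rw [arg_ofReal_of_nonneg Real.pi_pos.le]; exact Real.pi_ne_zero.symm),
        conj_ofReal]
    rw [e3]
    simp
  have := congrFun (h1.eq_of_eventuallyEq h2 hev) ((starRingEnd ℂ) s)
  simpa using this.symm

theorem norm_xi_one_sub_conj (s : ℂ) : ‖xi (1 - (starRingEnd ℂ) s)‖ = ‖xi s‖ := by
  rw [xi_one_sub, xi_conj, RCLike.norm_conj]

theorem xi_ne_zero {s : ℂ} (hs : 1 ≤ s.re) : xi s ≠ 0 := by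
  rcases eq_or_ne s 1 with rfl | h1
  · simp [xi]
  have h0 : s ≠ 0 := by rintro rfl; simp at hs; linarith
  have hG : Gamma (s / 2) ≠ 0 :=
    Gamma_ne_zero_of_re_pos (by simp only [div_ofNat_re]; linarith)
  rw [xi_eq h1 hG h0]
  have hpi : (Real.pi : ℂ) ^ (-s / 2) ≠ 0 := by
    simp [Complex.cpow_eq_zero_iff, Real.pi_ne_zero]
  exact mul_ne_zero (mul_ne_zero h0 (sub_ne_zero.mpr h1))
    (mul_ne_zero (mul_ne_zero hpi hG) (riemannZeta_ne_zero_of_one_le_re hs))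

theorem norm_xi_of_one_lt_re {s : ℂ} (hs : 1 < s.re) :
    ‖xi s‖ = ‖s‖ * ‖s - 1‖ * (Real.pi ^ (-s.re / 2) * ‖Gamma (s / 2)‖ * ‖riemannZeta s‖) := by
  rw [xi_eq_of_one_lt_re hs, norm_mul, norm_mul, norm_mul, norm_mul,
    norm_cpow_eq_rpow_re_of_pos Real.pi_pos]
  simp

/-- `Λ₀(s)` is half a Mellin transform at `s/2` that converges absolutely everywhere. In the strip
its kernel is bounded by the sum of the kernels at the two ends `-1/2` and `1`. -/
theorem exists_norm_completedRiemannZeta₀_le :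
    ∃ C > 0, ∀ s : ℂ, -1 ≤ s.re → s.re ≤ 2 → ‖completedRiemannZeta₀ s‖ ≤ C := by
  set Q := (HurwitzZeta.hurwitzEvenFEPair 0).toStrongFEPair with hQ
  have hstr : IsStrongFEPair Q := WeakFEPair.isStrongFEPair_toStrongFEPair _
  have hc (σ : ℝ) : IntegrableOn (fun t : ℝ => t ^ (σ - 1) * ‖Q.f t‖) (Ioi 0) := by
    have : IntegrableOn (fun t : ℝ => ‖(t : ℂ) ^ ((σ : ℂ) - 1) • Q.f t‖) (Ioi 0) :=
      ((hstr.hasMellin (σ : ℂ)).1).norm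
    refine this.congr_fun (fun t ht => ?_) measurableSet_Ioi
    simp [norm_cpow_eq_rpow_re_of_pos ht]
  set C := ∫ t in Ioi (0 : ℝ), (t ^ ((-1 / 2 : ℝ) - 1) * ‖Q.f t‖ + t ^ ((1 : ℝ) - 1) * ‖Q.f t‖)
  have hCnn : 0 ≤ C := setIntegral_nonneg measurableSet_Ioi fun t (ht : 0 < t) => by positivity
  refine ⟨C + 1, by linarith, fun s h1 h2 => ?_⟩
  have e : completedRiemannZeta₀ s = mellin Q.f (s / 2) / 2 := rfl
  have hm : ‖mellin Q.f (s / 2)‖ ≤ C := by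
    refine norm_integral_le_of_norm_le ((hc (-1/2)).add (hc 1)) ?_
    refine (ae_restrict_mem measurableSet_Ioi).mono fun t (ht : 0 < t) => ?_
    rw [norm_smul, norm_cpow_eq_rpow_re_of_pos ht]
    simp only [sub_re, div_ofNat_re, one_re]
    rw [← add_mul]
    gcongr
    rcases le_total t 1 with h | h
    · exact (Real.rpow_le_rpow_of_exponent_ge ht h (by linarith)).trans
        (le_add_of_nonneg_right (Real.rpow_nonneg ht.le _))
    · exact (Real.rpow_le_rpow_of_exponent_le h (by linarith)).trans
        (le_add_of_nonneg_left (Real.rpow_nonneg ht.le _))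
  rw [e, norm_div, Complex.norm_ofNat]
  linarith

end WengZeta

/-! ### Growth of `ξ` and comparison of its modulus at points symmetric about a vertical line -/

namespace WengZeta

open Complex Filter Topology Set MeasureTheory Asymptotics

/-- Far to the right, `ζ` is bounded above and below, and a horizontal move by at most `d` costs
only a constant in the powers of `π` and the Gamma factors. -/
theorem exists_norm_xi_le_of_two_le_re (d : ℝ) : ∃ K > 0, ∀ w v : ℂ, 2 ≤ w.re → w.re ≤ v.re →
    v.re ≤ w.re + d → w.im = v.im → ‖xi w‖ ≤ K * ‖xi v‖ := by
  obtain ⟨C, hC0, hC⟩ := exists_norm_riemannZeta_le one_lt_two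
  obtain ⟨c, hc0, hc⟩ := exists_le_norm_riemannZeta one_lt_two
  refine ⟨Real.pi ^ (d / 2) * 4 * (C / c), by positivity, fun w v hw hwv hvd him => ?_⟩
  have hsub (a : ℝ) (ha : a ≤ 1) : ‖w - a‖ ≤ ‖v - a‖ := by
    rw [norm_def, norm_def]
    apply Real.sqrt_le_sqrt
    simp only [normSq_apply, sub_re, ofReal_re, sub_im, ofReal_im, him]
    nlinarith
  have h0 : ‖w‖ ≤ ‖v‖ := by simpa using hsub 0 (by norm_num)
  have h1 : ‖w - 1‖ ≤ ‖v - 1‖ := by simpa using hsub 1 le_rfl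
  rw [norm_xi_of_one_lt_re (by linarith), norm_xi_of_one_lt_re (by linarith)]
  have hpi : Real.pi ^ (-w.re / 2) ≤ Real.pi ^ (d / 2) * Real.pi ^ (-v.re / 2) := by
    rw [← Real.rpow_add Real.pi_pos]
    exact Real.rpow_le_rpow_of_exponent_le (by linarith [Real.pi_gt_three]) (by linarith)
  have hG : ‖Gamma (w / 2)‖ ≤ 4 * ‖Gamma (v / 2)‖ := by
    have hv : v / 2 = w / 2 + ((v.re / 2 - w.re / 2 : ℝ) : ℂ) := by
      apply Complex.ext <;> simp [him]
    have h := norm_Gamma_mul_Gamma_le (w := w / 2) (by simp; linarith)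
      (d := v.re / 2 - w.re / 2) (by linarith)
    rw [← hv, div_ofNat_re, add_sub_cancel] at h
    have h4 := Gamma_le_four_mul_Gamma (a := w.re / 2) (b := v.re / 2) (by linarith) (by linarith)
    have hp : 0 < Real.Gamma (v.re / 2) := Real.Gamma_pos_of_pos (by linarith)
    refine le_of_mul_le_mul_right (h.trans ?_) hp
    nlinarith [norm_nonneg (Gamma (v / 2))]
  have hz : ‖riemannZeta w‖ ≤ C / c * ‖riemannZeta v‖ := by
    calc ‖riemannZeta w‖ ≤ C := hC w hw
      _ = C / c * c := by field_simp
      _ ≤ _ := by gcongr; exact hc v (by linarith)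
  calc ‖w‖ * ‖w - 1‖ * (Real.pi ^ (-w.re / 2) * ‖Gamma (w / 2)‖ * ‖riemannZeta w‖)
      ≤ ‖v‖ * ‖v - 1‖ * ((Real.pi ^ (d / 2) * Real.pi ^ (-v.re / 2)) *
        (4 * ‖Gamma (v / 2)‖) * (C / c * ‖riemannZeta v‖)) := by gcongr
    _ = _ := by ring

/-- A crude growth bound for use in Phragmén–Lindelöf: any exponential of a multiple of `‖v‖` would
do. Of the `10`, `9` bounds `ξ(u)` from above and `1` absorbs the decay of `Γ(v/2)`. -/
theorem exists_norm_xi_le_of_strip {σ τ : ℝ} (hσ : 1 < σ) : ∃ K > 0, ∀ u v : ℂ,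
    -1 ≤ u.re → u.re ≤ 2 → σ ≤ v.re → v.re ≤ τ → u.im = v.im →
      ‖xi u‖ ≤ K * Real.exp (10 * ‖v‖) * ‖xi v‖ := by
  obtain ⟨C, hC0, hC⟩ := exists_norm_completedRiemannZeta₀_le
  obtain ⟨c, hc0, hc⟩ := exists_le_norm_riemannZeta hσ
  obtain ⟨g, hg0, hg⟩ : ∃ g > 0, ∀ x ∈ Icc (σ / 2) (τ / 2), g ≤ Real.Gamma x := by
    rcases (Icc (σ / 2) (τ / 2)).eq_empty_or_nonempty with h | h
    · exact ⟨1, one_pos, by simp [h]⟩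
    · have hcont : ContinuousOn Real.Gamma (Icc (σ / 2) (τ / 2)) := fun x hx =>
        (Real.differentiableAt_Gamma fun m => by
          have : 0 < x := by linarith [hx.1]
          have : (0 : ℝ) ≤ m := m.cast_nonneg
          linarith).continuousAt.continuousWithinAt
      obtain ⟨x, hx, hmin⟩ := isCompact_Icc.exists_isMinOn h hcont
      exact ⟨_, Real.Gamma_pos_of_pos (by linarith [hx.1]), fun y hy => hmin hy⟩
  set m := σ * (σ - 1) * (Real.pi ^ (-τ / 2) * g * c) with hm
  have hm0 : 0 < m := by have := sub_pos.mpr hσ; positivity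
  refine ⟨(C + 1) / m, by positivity, fun u v hu1 hu2 hv1 hv2 him => ?_⟩
  have hv0 : σ ≤ ‖v‖ := hv1.trans ((le_abs_self _).trans (abs_re_le_norm v))
  have hv1' : σ - 1 ≤ ‖v - 1‖ := by
    refine le_trans ?_ ((le_abs_self _).trans (abs_re_le_norm (v - 1)))
    simpa using hv1
  have himv : |v.im| ≤ ‖v‖ := abs_im_le_norm v
  have hlow : m * Real.exp (-‖v‖) ≤ ‖xi v‖ := by
    rw [norm_xi_of_one_lt_re (by linarith)]
    have hG := le_norm_Gamma (w := v / 2) (by simp; linarith)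
    rw [div_ofNat_re, div_ofNat_im] at hG
    have hG' : g * Real.exp (-‖v‖) ≤ ‖Gamma (v / 2)‖ := by
      refine le_trans ?_ hG
      have hexp : -‖v‖ ≤ -(Real.pi * |v.im / 2| / 2) := by
        rw [abs_div, abs_two]
        nlinarith [Real.pi_le_four, abs_nonneg v.im]
      exact mul_le_mul (hg _ ⟨by linarith, by linarith⟩) (Real.exp_le_exp.mpr hexp)
        (Real.exp_pos _).le (Real.Gamma_pos_of_pos (by linarith)).le
    have hpi : Real.pi ^ (-τ / 2) ≤ Real.pi ^ (-v.re / 2) :=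
      Real.rpow_le_rpow_of_exponent_le (by linarith [Real.pi_gt_three]) (by linarith)
    calc m * Real.exp (-‖v‖)
        = σ * (σ - 1) * (Real.pi ^ (-τ / 2) * (g * Real.exp (-‖v‖)) * c) := by rw [hm]; ring
      _ ≤ _ := by gcongr; exact hc v hv1
  have hup : ‖xi u‖ ≤ (C + 1) * Real.exp (9 * ‖v‖) := by
    have hu : ‖u‖ ≤ 3 * ‖v‖ := by
      have := norm_le_abs_re_add_abs_im u
      rw [him] at this
      have : |u.re| ≤ 2 := abs_le.mpr ⟨by linarith, hu2⟩
      linarith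
    have hu' : ‖u - 1‖ ≤ 4 * ‖v‖ := by
      have := norm_sub_le u 1
      rw [norm_one] at this
      linarith
    have h := hC u hu1 hu2
    have hexp (x : ℝ) : x ≤ Real.exp x := by linarith [Real.add_one_le_exp x]
    calc ‖xi u‖ ≤ ‖u‖ * ‖u - 1‖ * ‖completedRiemannZeta₀ u‖ + 1 := by
          rw [xi]
          refine (norm_add_le _ _).trans ?_
          rw [norm_mul, norm_mul, norm_one]
      _ ≤ Real.exp (3 * ‖v‖) * Real.exp (4 * ‖v‖) * C + 1 := by
          gcongr
          · exact hu.trans (hexp _)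
          · exact hu'.trans (hexp _)
      _ ≤ Real.exp (9 * ‖v‖) * C + Real.exp (9 * ‖v‖) := by
          rw [← Real.exp_add]
          gcongr
          · linarith [norm_nonneg v]
          · exact Real.one_le_exp (by positivity)
      _ = _ := by ring
  calc ‖xi u‖ ≤ (C + 1) * Real.exp (9 * ‖v‖) := hup
    _ = (C + 1) / m * Real.exp (10 * ‖v‖) * (m * Real.exp (-‖v‖)) := by
        have : Real.exp (10 * ‖v‖) * Real.exp (-‖v‖) = Real.exp (9 * ‖v‖) := by
          rw [← Real.exp_add]; ring_nf
        rw [← this]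
        field_simp
    _ ≤ _ := by gcongr

/-- The quotient of the two sides has modulus `1` on the imaginary axis, no poles in `Re z ≥ 0`,
exponential growth of order one and a bound on the real axis near infinity. Strictness of `b < 0`
keeps the denominator in `Re ≥ 1 - b > 1`, where `|ζ|` is bounded below. -/
theorem norm_xi_add_le_of_neg {b : ℝ} (hb : b < 0) {z : ℂ} (hz : 0 ≤ z.re) :
    ‖xi (z + b)‖ ≤ ‖xi (z + 1 - b)‖ := by
  have hden {z : ℂ} (hz : 0 ≤ z.re) : xi (z + 1 - b) ≠ 0 := xi_ne_zero (by simp; linarith)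
  set F : ℂ → ℂ := fun z => xi (z + b) / xi (z + 1 - b) with hF
  suffices ‖F z‖ ≤ 1 by
    rw [hF, norm_div] at this
    exact (div_le_one (norm_pos_iff.mpr (hden hz))).mp this
  have hx := differentiable_xi
  obtain ⟨K₁, hK₁0, hK₁⟩ := exists_norm_xi_le_of_two_le_re (1 - 2 * b)
  obtain ⟨K₂, hK₂0, hK₂⟩ :=
    exists_norm_xi_le_of_strip (σ := 1 - b) (τ := 3 - 2 * b) (by linarith)
  have hbig {z : ℂ} (hz : 0 ≤ z.re) (h : 2 ≤ z.re + b) : ‖F z‖ ≤ K₁ := by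
    rw [hF, norm_div, div_le_iff₀ (norm_pos_iff.mpr (hden hz))]
    exact hK₁ _ _ (by simpa using h) (by simp; linarith) (by simp; linarith) (by simp)
  have hgrow {z : ℂ} (hz : 0 ≤ z.re) :
      ‖F z‖ ≤ (K₁ + K₂ * Real.exp (10 * (1 - b))) * Real.exp (10 * ‖z‖) := by
    have he : 1 ≤ Real.exp (10 * ‖z‖) := Real.one_le_exp (by positivity)
    have hsmall : K₁ ≤ (K₁ + K₂ * Real.exp (10 * (1 - b))) * Real.exp (10 * ‖z‖) := by
      nlinarith [mul_pos hK₂0 (Real.exp_pos (10 * (1 - b)))]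
    rcases le_total 2 (z.re + b) with h | h
    · exact (hbig hz h).trans hsmall
    rcases le_total (z.re + b) (-1) with h' | h'
    -- The reflection in the critical line moves `z + b` to real part at least `2` without changing
    -- `|ξ|` or the imaginary part.
    · refine le_trans ?_ hsmall
      rw [hF, norm_div, div_le_iff₀ (norm_pos_iff.mpr (hden hz)), ← norm_xi_one_sub_conj]
      exact hK₁ _ _ (by simp; linarith) (by simp; linarith) (by simp; linarith) (by simp)
    · rw [hF, norm_div, div_le_iff₀ (norm_pos_iff.mpr (hden hz))]
      refine (hK₂ (z + b) (z + 1 - b) (by simpa using h') (by simpa using h)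
        (by simp; linarith) (by simp; linarith) (by simp)).trans ?_
      refine mul_le_mul_of_nonneg_right ?_ (norm_nonneg _)
      have h1 : ‖z + 1 - b‖ ≤ ‖z‖ + (1 - b) := by
        have e : z + 1 - (b : ℂ) = z + ((1 - b : ℝ) : ℂ) := by push_cast; ring
        rw [e]
        refine (norm_add_le _ _).trans ?_
        rw [norm_real, Real.norm_of_nonneg (by linarith)]
      calc K₂ * Real.exp (10 * ‖z + 1 - b‖) ≤ K₂ * Real.exp (10 * (‖z‖ + (1 - b))) := by gcongr
        _ = K₂ * Real.exp (10 * (1 - b)) * Real.exp (10 * ‖z‖) := by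
          rw [mul_assoc, ← Real.exp_add]; ring_nf
        _ ≤ _ := by gcongr; linarith
  refine PhragmenLindelof.right_half_plane_of_bounded_on_real (f := F) ?_ ?_ ?_ ?_ hz
  · refine DifferentiableOn.diffContOnCl fun z hz => ?_
    have hz' : 0 ≤ z.re := by
      rw [closure_setOfPred_lt_re] at hz
      exact hz
    have : DifferentiableAt ℂ F z := by
      refine DifferentiableAt.div ?_ ?_ (hden hz') <;> fun_prop
    exact this.differentiableWithinAt
  · refine ⟨1, one_lt_two, 10, IsBigO.of_bound (K₁ + K₂ * Real.exp (10 * (1 - b))) ?_⟩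
    refine Filter.Eventually.filter_mono inf_le_right ?_
    refine eventually_principal.mpr fun z hz => ?_
    rw [Real.rpow_one, Real.norm_of_nonneg (Real.exp_pos _).le]
    exact hgrow (le_of_lt hz)
  · refine ⟨K₁, ?_⟩
    rw [eventually_map]
    filter_upwards [eventually_ge_atTop (2 - b)] with x hx
    exact hbig (by simp; linarith) (by simp; linarith)
  · intro x
    rw [hF, norm_div, ← norm_xi_one_sub_conj]
    have e : 1 - (starRingEnd ℂ) (x * I + b) = x * I + 1 - b := by
      simp
      ring
    rw [e, div_self]
    exact norm_ne_zero_iff.mpr (hden (by simp))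

/-- The reflection of `z + b` in the line `Re = Re b` is `1 - (z + 1 - b)` up to conjugation, and
moving away from the critical line increases `|ξ|`. -/
theorem norm_xi_add_le {b : ℝ} (hb : b ≤ 0) {z : ℂ} (hz : 0 ≤ z.re) :
    ‖xi (z + b)‖ ≤ ‖xi (z + 1 - b)‖ := by
  have hx := differentiable_xi.continuous
  have h1 : Tendsto (fun t : ℝ => ‖xi (z + t)‖) (𝓝[<] b) (𝓝 ‖xi (z + b)‖) :=
    (Continuous.tendsto (f := fun t : ℝ => ‖xi (z + t)‖) (by fun_prop) b).mono_left
      nhdsWithin_le_nhds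
  have h2 : Tendsto (fun t : ℝ => ‖xi (z + 1 - t)‖) (𝓝[<] b) (𝓝 ‖xi (z + 1 - b)‖) :=
    (Continuous.tendsto (f := fun t : ℝ => ‖xi (z + 1 - t)‖) (by fun_prop) b).mono_left
      nhdsWithin_le_nhds
  refine le_of_tendsto_of_tendsto h1 h2 ?_
  filter_upwards [self_mem_nhdsWithin] with t ht
  exact norm_xi_add_le_of_neg (lt_of_lt_of_le ht hb) hz

theorem tendsto_norm_xi_two_mul_natCast :
    Tendsto (fun m : ℕ => ‖xi ((2 * (m + 1) : ℕ) : ℂ)‖) atTop atTop := by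
  obtain ⟨c, hc0, hc⟩ := exists_le_norm_riemannZeta one_lt_two
  have h0 : Tendsto (fun m : ℕ => Real.pi ^ m / (m.factorial : ℝ)) atTop (𝓝[>] 0) :=
    tendsto_nhdsWithin_iff.mpr ⟨FloorSemiring.tendsto_pow_div_factorial_atTop Real.pi,
      Eventually.of_forall fun m => by simp only [mem_Ioi]; positivity⟩
  have hf := h0.inv_tendsto_nhdsGT_zero.atTop_mul_const (show 0 < c / Real.pi by positivity)
  refine tendsto_atTop_mono (fun m => ?_) hf
  have hre : (((2 * (m + 1) : ℕ) : ℂ)).re = 2 * (m + 1) := by simp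
  have hm : (0 : ℝ) ≤ m := m.cast_nonneg
  rw [norm_xi_of_one_lt_re (by rw [hre]; linarith), hre]
  have e1 : ((2 * (m + 1) : ℕ) : ℂ) / 2 = m + 1 := by push_cast; ring
  have e2 : -(2 * ((m : ℝ) + 1)) / 2 = -((m + 1 : ℕ) : ℝ) := by push_cast; ring
  rw [e1, Complex.Gamma_nat_eq_factorial, norm_natCast, e2, Real.rpow_neg Real.pi_pos.le,
    Real.rpow_natCast, pow_succ, norm_natCast]
  have h1 : (1 : ℝ) ≤ ((2 * (m + 1) : ℕ) : ℝ) := by push_cast; linarith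
  have h2 : (1 : ℝ) ≤ ‖((2 * (m + 1) : ℕ) : ℂ) - 1‖ := by
    have : ((2 * (m + 1) : ℕ) : ℂ) - 1 = ((2 * m + 1 : ℕ) : ℂ) := by push_cast; ring
    rw [this, norm_natCast]
    push_cast
    linarith
  have h3 := hc ((2 * (m + 1) : ℕ) : ℂ) (by rw [hre]; linarith)
  simp only [Pi.inv_apply]
  calc (Real.pi ^ m / (m.factorial : ℝ))⁻¹ * (c / Real.pi)
      = 1 * 1 * ((Real.pi ^ m * Real.pi)⁻¹ * m.factorial * c) := by field_simp
    _ ≤ _ := by gcongr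

/-- Equality at one point would make the quotient constant by the maximum principle. Then `|ξ|`
would be periodic on the real axis, hence bounded there, but it tends to infinity along the even
integers. -/
theorem norm_xi_add_lt {b : ℝ} (hb : b ≤ 0) {z : ℂ} (hz : 0 < z.re) :
    ‖xi (z + b)‖ < ‖xi (z + 1 - b)‖ := by
  refine (norm_xi_add_le hb hz.le).lt_of_ne fun heq => ?_
  have hx := differentiable_xi
  have hden {w : ℂ} (hw : 0 ≤ w.re) : xi (w + 1 - b) ≠ 0 := xi_ne_zero (by simp; linarith)
  set F : ℂ → ℂ := fun w => xi (w + b) / xi (w + 1 - b) with hF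
  set U : Set ℂ := {w | 0 < w.re}
  have hUo : IsOpen U := isOpen_lt continuous_const continuous_re
  have hFz : ‖F z‖ = 1 := by
    rw [hF, norm_div, heq, div_self (norm_ne_zero_iff.mpr (hden hz.le))]
  have hconst : EqOn F (Function.const ℂ (F z)) U := by
    refine eqOn_of_isPreconnected_of_isMaxOn_norm (convex_halfSpace_re_gt 0).isPreconnected hUo
      (fun w hw => ?_) hz fun w hw => ?_
    · have : DifferentiableAt ℂ F w := by
        refine DifferentiableAt.div ?_ ?_ (hden (le_of_lt hw)) <;> fun_prop
      exact this.differentiableWithinAt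
    · simp only [Function.comp_apply, mem_ofPred_eq, hFz]
      rw [hF, norm_div]
      exact div_le_one_of_le₀ (norm_xi_add_le hb (le_of_lt hw)) (norm_nonneg _)
  have hall : (fun w => xi (w + b)) = fun w => F z * xi (w + 1 - b) := by
    refine AnalyticOnNhd.eq_of_eventuallyEq (𝕜 := ℂ) (z₀ := z)
      (fun w _ => Differentiable.analyticAt (by fun_prop) w)
      (fun w _ => Differentiable.analyticAt (by fun_prop) w) ?_
    filter_upwards [hUo.mem_nhds hz] with w hw
    have : xi (w + b) / xi (w + 1 - b) = F z := hconst hw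
    rw [← this, div_mul_cancel₀ _ (hden (le_of_lt hw))]
  have hper : Function.Periodic (fun x : ℝ => ‖xi x‖) (1 - 2 * b) := fun x => by
    have := congrArg norm (congrFun hall ((x - b : ℝ) : ℂ))
    rw [norm_mul, hFz, one_mul] at this
    have e1 : ((x - b : ℝ) : ℂ) + b = x := by push_cast; ring
    have e2 : ((x - b : ℝ) : ℂ) + 1 - b = ((x + (1 - 2 * b) : ℝ) : ℂ) := by push_cast; ring
    rw [e1, e2] at this
    exact this.symm
  have hcont : Continuous fun x : ℝ => ‖xi x‖ := by
    have := hx.continuous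
    fun_prop
  obtain ⟨B, hB⟩ := (hper.compact_of_continuous (by linarith) hcont).bddAbove
  obtain ⟨m, hm⟩ := (tendsto_norm_xi_two_mul_natCast.eventually_gt_atTop B).exists
  have := hB ⟨((2 * (m + 1) : ℕ) : ℝ), rfl⟩
  simp only [ofReal_natCast] at this
  linarith

end WengZeta

/-! ### Domination of analytic functions, and multisets of weights that split into strings -/

namespace WengZeta

open Complex Filter Topology

/-- Near `t` the function `N` is a multiple of `D` by an analytic function of modulus at most `1`
at `t`, and less than `1` if `S` holds. -/
def DominatedAt (S : Prop) (t : ℂ) (N D : ℂ → ℂ) : Prop :=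
  ∃ H : ℂ → ℂ, AnalyticAt ℂ H t ∧ N =ᶠ[𝓝 t] H * D ∧ ‖H t‖ ≤ 1 ∧ (S → ‖H t‖ < 1)

namespace DominatedAt

variable {S S' : Prop} {t : ℂ} {N N' D D' : ℂ → ℂ}

theorem refl (N : ℂ → ℂ) : DominatedAt False t N N :=
  ⟨1, analyticAt_const, by simp, by simp, False.elim⟩

theorem mono (h : DominatedAt S t N D) (hS : S' → S) : DominatedAt S' t N D := by
  obtain ⟨H, h1, h2, h3, h4⟩ := h
  exact ⟨H, h1, h2, h3, h4 ∘ hS⟩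

theorem mul (h : DominatedAt S t N D) (h' : DominatedAt S' t N' D') :
    DominatedAt (S ∨ S') t (N * N') (D * D') := by
  obtain ⟨H, h1, h2, h3, h4⟩ := h
  obtain ⟨H', h1', h2', h3', h4'⟩ := h'
  refine ⟨H * H', h1.mul h1', ?_, ?_, ?_⟩
  · filter_upwards [h2, h2'] with z hz hz'
    simp only [Pi.mul_apply] at hz hz' ⊢
    rw [hz, hz']
    ring
  · simp only [Pi.mul_apply, norm_mul]
    exact mul_le_one₀ h3 (norm_nonneg _) h3'
  · simp only [Pi.mul_apply, norm_mul]
    rintro (hS | hS)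
    · exact mul_lt_one_of_nonneg_of_lt_one_left (norm_nonneg _) (h4 hS) h3'
    · exact mul_lt_one_of_nonneg_of_lt_one_right h3 (norm_nonneg _) (h4' hS)

theorem mul_left (C : ℂ → ℂ) (h : DominatedAt S t N D) : DominatedAt S t (C * N) (C * D) :=
  ((refl C).mul h).mono Or.inr

theorem of_norm_le (hN : AnalyticAt ℂ N t) (hD : AnalyticAt ℂ D t) (h0 : D t ≠ 0)
    (hle : ‖N t‖ ≤ ‖D t‖) (hlt : S → ‖N t‖ < ‖D t‖) : DominatedAt S t N D := by
  have hp : 0 < ‖D t‖ := norm_pos_iff.mpr h0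
  refine ⟨N / D, hN.div hD h0, ?_, ?_, ?_⟩
  · filter_upwards [hD.continuousAt.eventually_ne h0] with z hz
    simp [div_mul_cancel₀ _ hz]
  · rw [Pi.div_apply, norm_div]
    exact (div_le_one hp).mpr hle
  · rw [Pi.div_apply, norm_div]
    exact fun h => (div_lt_one hp).mpr (hlt h)

theorem finset_prod {κ : Type*} {I : Finset κ} {S : κ → Prop} {N D : κ → ℂ → ℂ}
    (h : ∀ i ∈ I, DominatedAt (S i) t (N i) (D i)) :
    DominatedAt (∃ i ∈ I, S i) t (∏ i ∈ I, N i) (∏ i ∈ I, D i) := by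
  classical
  induction I using Finset.induction_on with
  | empty => simpa using (refl (1 : ℂ → ℂ)).mono (by simp)
  | insert i I hi ih =>
    rw [Finset.prod_insert hi, Finset.prod_insert hi]
    refine ((h i (Finset.mem_insert_self i I)).mul
      (ih fun j hj => h j (Finset.mem_insert_of_mem hj))).mono ?_
    simp

end DominatedAt

/-- The weights `-m, -m + 2, …, m` of the irreducible representation of `𝔰𝔩₂` of dimension
`m + 1`. -/
def weightString (m : ℕ) : Multiset ℤ := (Multiset.range (m + 1)).map fun i : ℕ => -(m : ℤ) + 2 * i

theorem mem_weightString {m : ℕ} {n : ℤ} :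
    n ∈ weightString m ↔ ∃ i : ℕ, i ≤ m ∧ n = -(m : ℤ) + 2 * i := by
  simp only [weightString, Multiset.mem_map, Multiset.mem_range, Nat.lt_succ_iff]
  simp only [eq_comm]

theorem nodup_weightString (m : ℕ) : (weightString m).Nodup :=
  (Multiset.nodup_range _).map fun i j h => by simpa using h

/-- A multiset of weights with the properties that hold for a graded space with an operator of
degree `2` such that `e ^ n` is injective in degree `-n` for `n > 0` and `e` in all negative
degrees. -/
structure IsLefschetz (s : Multiset ℤ) : Prop where
  count_le_count_add : ∀ n < 0, s.count n ≤ s.count (n + 2)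
  count_le_count_neg : ∀ n < 0, s.count n ≤ s.count (-n)

theorem IsLefschetz.weightString_le {s : Multiset ℤ} (hs : IsLefschetz s) {m : ℕ}
    (hm : -(m : ℤ) ∈ s) : weightString m ≤ s := by
  rw [Multiset.le_iff_subset (nodup_weightString m)]
  -- Steps of `2` may start from any negative weight, so they reach `0` or `1`. Larger weights come
  -- from the symmetry `n ↦ -n`.
  have hneg : ∀ i : ℕ, -(m : ℤ) + 2 * i < 2 → -(m : ℤ) + 2 * i ∈ s := by
    intro i
    induction i with
    | zero => exact fun _ => by simpa using hm
    | succ i ih =>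
      intro h
      push_cast at h ⊢
      have h1 := ih (by lia)
      have h2 := hs.count_le_count_add (-(m : ℤ) + 2 * i) (by lia)
      rw [← Multiset.one_le_count_iff_mem] at h1 ⊢
      have e : -(m : ℤ) + 2 * (i + 1) = -(m : ℤ) + 2 * i + 2 := by ring
      rw [e]
      exact h1.trans h2
  intro n hn
  obtain ⟨i, hi, rfl⟩ := mem_weightString.mp hn
  by_cases h : -(m : ℤ) + 2 * i < 2
  · exact hneg i h
  · have h1 := hneg (m - i) (by lia)
    have h2 := hs.count_le_count_neg (-(m : ℤ) + 2 * ((m - i : ℕ) : ℤ)) (by lia)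
    rw [← Multiset.one_le_count_iff_mem] at h1 ⊢
    have e : -(-(m : ℤ) + 2 * ((m - i : ℕ) : ℤ)) = -(m : ℤ) + 2 * i := by
      push_cast [Nat.cast_sub hi]
      ring
    rw [e] at h2
    exact h1.trans h2

theorem IsLefschetz.sub_weightString {s : Multiset ℤ} (hs : IsLefschetz s) {m : ℕ}
    (hmin : ∀ n ∈ s, -(m : ℤ) ≤ n) : IsLefschetz (s - weightString m) := by
  have hc (n : ℤ) : (weightString m).count n = if n ∈ weightString m then 1 else 0 :=
    Multiset.count_eq_of_nodup (nodup_weightString m)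
  constructor
  · intro n hn
    have h1 := hs.count_le_count_add n hn
    rw [Multiset.count_sub, Multiset.count_sub, hc, hc]
    by_cases h2 : n + 2 ∈ weightString m
    · by_cases h3 : n ∈ weightString m
      · rw [if_pos h2, if_pos h3]
        lia
      -- Here `n + 2` can only be the bottom `-m` of the string, so `n` lies below the least weight
      -- of `s`.
      · have : s.count n = 0 := by
          rw [Multiset.count_eq_zero]
          intro h
          have := hmin n h
          obtain ⟨i, hi, h4⟩ := mem_weightString.mp h2
          exact h3 (mem_weightString.mpr ⟨i - 1, by lia, by lia⟩)
        lia
    · rw [if_neg h2]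
      lia
  · intro n hn
    have h1 := hs.count_le_count_neg n hn
    rw [Multiset.count_sub, Multiset.count_sub, hc, hc]
    have : -n ∈ weightString m ↔ n ∈ weightString m := by
      rw [mem_weightString, mem_weightString]
      constructor <;> rintro ⟨i, hi, h⟩ <;> exact ⟨m - i, by lia, by lia⟩
    simp only [this]
    split_ifs <;> lia

/-- If the least weight `-m` is negative, the whole string up to `m` can be removed: its quotient
telescopes to `G (-m) / G (m + 2)`, and the rest is again Lefschetz. Once no negative weight
remains, the factors are dominated one by one. -/
theorem IsLefschetz.dominatedAt {S : Prop} {t : ℂ} {G : ℤ → ℂ → ℂ}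
    (hG : ∀ n ≤ 0, DominatedAt S t (G n) (G (2 - n)))
    (hG' : ∀ n ≥ 0, DominatedAt S t (G n) (G (n + 2))) {s : Multiset ℤ} (hs : IsLefschetz s) :
    DominatedAt (S ∧ s ≠ 0) t (s.map G).prod (s.map fun n => G (n + 2)).prod := by
  induction h : Multiset.card s using Nat.strong_induction_on generalizing s with
  | _ N ih =>
    by_cases hpos : ∀ n ∈ s, 0 ≤ n
    · clear hs h ih
      induction s using Multiset.induction_on with
      | empty => simpa using (DominatedAt.refl (t := t) (1 : ℂ → ℂ)).mono (by simp)
      | cons n s ih =>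
        rw [Multiset.map_cons, Multiset.map_cons, Multiset.prod_cons, Multiset.prod_cons]
        refine ((hG' n (hpos n (Multiset.mem_cons_self n s))).mul
          (ih fun k hk => hpos k (Multiset.mem_cons_of_mem hk))).mono ?_
        exact fun h => Or.inl h.1
    · push Not at hpos
      obtain ⟨n₀, hn₀, hn₀'⟩ := hpos
      obtain ⟨n, hn, hmin⟩ := s.toFinset.exists_min_image id ⟨n₀, Multiset.mem_toFinset.mpr hn₀⟩
      simp only [Multiset.mem_toFinset, id_eq] at hn hmin
      have hneg : n < 0 := (hmin n₀ hn₀).trans_lt hn₀'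
      obtain ⟨m, rfl⟩ : ∃ m : ℕ, n = -(m : ℤ) := ⟨n.natAbs, by lia⟩
      have hle := hs.weightString_le hn
      have hsplit : s = weightString m + (s - weightString m) := (add_tsub_cancel_of_le hle).symm
      have hcard : Multiset.card (s - weightString m) < N := by
        have := congrArg Multiset.card hsplit
        rw [Multiset.card_add, h] at this
        have h2 : Multiset.card (weightString m) = m + 1 := by simp [weightString]
        lia
      have ih' := ih _ hcard (hs.sub_weightString hmin) rfl
      rw [hsplit, Multiset.map_add, Multiset.map_add, Multiset.prod_add, Multiset.prod_add]
      refine DominatedAt.mono (S := S ∨ _) (DominatedAt.mul ?_ ih') fun h => Or.inl h.1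
      set g : ℕ → ℂ → ℂ := fun i => G (-(m : ℤ) + 2 * i) with hg
      have e1 : ((weightString m).map G).prod = (∏ i ∈ Finset.range m, g (i + 1)) * G (-m) := by
        rw [weightString, Multiset.map_map]
        change ∏ i ∈ Finset.range (m + 1), g i = _
        rw [Finset.prod_range_succ']
        simp [hg]
      have e2 : ((weightString m).map fun n => G (n + 2)).prod =
          (∏ i ∈ Finset.range m, g (i + 1)) * G (2 - -m) := by
        rw [weightString, Multiset.map_map]
        have : ((Multiset.range (m + 1)).map
            ((fun n => G (n + 2)) ∘ fun i : ℕ => -(m : ℤ) + 2 * i)).prod =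
            ∏ i ∈ Finset.range (m + 1), g (i + 1) := by
          refine congrArg Multiset.prod (Multiset.map_congr rfl fun i _ => ?_)
          simp only [Function.comp_apply, hg]
          congr 1
          push_cast
          ring
        rw [this, Finset.prod_range_succ]
        congr 1
        simp only [hg]
        congr 1
        push_cast
        ring
      rw [e1, e2]
      exact (hG _ (by lia)).mul_left _

theorem dominatedAt_prod_xi {κ : Type*} {I : Finset κ} {a : κ → ℤ}
    (hI : IsLefschetz (I.val.map a)) {k : ℝ} (hk : 0 < k) {t : ℂ} (ht : 0 ≤ t.re) :
    DominatedAt (0 < t.re ∧ I.Nonempty) t (∏ i ∈ I, fun t => xi (k * t + (a i : ℂ) / 2))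
      (∏ i ∈ I, fun t => xi (k * t + (a i : ℂ) / 2 + 1)) := by
  have hx := differentiable_xi
  have han (n : ℤ) : AnalyticAt ℂ (fun t => xi (k * t + (n : ℂ) / 2)) t :=
    Differentiable.analyticAt (by fun_prop) t
  have hkt : 0 ≤ (k * t).re := by simp; positivity
  have hre (n : ℤ) : (k * t + (n : ℂ) / 2).re = k * t.re + n / 2 := by simp
  have key := hI.dominatedAt (S := 0 < t.re) (t := t)
    (G := fun n t => xi (k * t + (n : ℂ) / 2)) ?_ ?_
  · rw [Multiset.map_map, Multiset.map_map] at key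
    refine (?_ : DominatedAt (0 < t.re ∧ Multiset.map a I.val ≠ 0) t _ _).mono ?_
    · have e : (∏ i ∈ I, fun t => xi (k * t + (a i : ℂ) / 2 + 1)) =
          (I.val.map ((fun (n : ℤ) t => xi (k * t + ((n + 2 : ℤ) : ℂ) / 2)) ∘ a)).prod := by
        refine Finset.prod_congr rfl fun i _ => ?_
        funext t
        simp only [Function.comp_apply]
        push_cast
        ring_nf
      rw [e]
      exact key
    · rintro ⟨h1, h2⟩
      refine ⟨h1, ?_⟩
      simpa [Multiset.map_eq_zero] using h2.ne_empty
  · intro n hn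
    have hn' : (n : ℝ) ≤ 0 := by exact_mod_cast hn
    have e1 : (n : ℂ) / 2 = ((n / 2 : ℝ) : ℂ) := by push_cast; rfl
    have e2 : k * t + ((2 - n : ℤ) : ℂ) / 2 = k * t + 1 - ((n / 2 : ℝ) : ℂ) := by push_cast; ring
    refine .of_norm_le (han _) (han _) (xi_ne_zero ?_) ?_ fun h => ?_
    · rw [hre]
      push_cast
      have : 0 ≤ k * t.re := by positivity
      linarith
    · rw [e2, e1]
      exact norm_xi_add_le (by linarith) hkt
    · rw [e2, e1]
      exact norm_xi_add_lt (by linarith) (by simp; positivity)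
  · intro n hn
    have hn' : (0 : ℝ) ≤ n := by exact_mod_cast hn
    have e : k * t + ((n + 2 : ℤ) : ℂ) / 2 = k * t + n / 2 + 1 := by push_cast; ring
    have h1 := norm_xi_add_le (b := 0) le_rfl (z := k * t + n / 2) (by rw [hre]; positivity)
    simp only [ofReal_zero, add_zero, sub_zero] at h1
    refine .of_norm_le (han _) (han _) (xi_ne_zero ?_) ?_ fun h => ?_
    · rw [hre]
      push_cast
      have : 0 ≤ k * t.re := by positivity
      linarith
    · rw [e]
      exact h1
    · rw [e]
      have h2 := norm_xi_add_lt (b := 0) le_rfl (z := k * t + n / 2) (by rw [hre]; positivity)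
      simpa using h2

end WengZeta

/-! ### Lefschetz properties of representations of `𝔰𝔩₂` -/

namespace SlTwo

variable {V : Type*} [AddCommGroup V] [Module ℝ V] {e f h : Module.End ℝ V}

/-- A shifted multiple of the Casimir operator. -/
def casimir (e f h : Module.End ℝ V) : Module.End ℝ V := (h + 1) * (h + 1) + (4 : ℝ) • (f * e)

theorem four_smul (x : Module.End ℝ V) : (4 : ℝ) • x = 4 * x := by
  rw [Algebra.smul_def, map_ofNat]

theorem apply_e (he : h * e - e * h = (2 : ℝ) • e) {ν : ℝ} {v : V} (hv : h v = ν • v) :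
    h (e v) = (ν + 2) • e v := by
  have := LinearMap.congr_fun he v
  simp only [LinearMap.sub_apply, Module.End.mul_apply, LinearMap.smul_apply, hv, map_smul] at this
  rw [sub_eq_iff_eq_add] at this
  rw [this]
  module

theorem apply_f (hf : h * f - f * h = (-2 : ℝ) • f) {ν : ℝ} {v : V} (hv : h v = ν • v) :
    h (f v) = (ν - 2) • f v := by
  have := LinearMap.congr_fun hf v
  simp only [LinearMap.sub_apply, Module.End.mul_apply, LinearMap.smul_apply, hv, map_smul] at this
  rw [sub_eq_iff_eq_add] at this
  rw [this]
  module

theorem apply_pow_e (he : h * e - e * h = (2 : ℝ) • e) {ν : ℝ} {v : V} (hv : h v = ν • v) (n : ℕ) :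
    h ((e ^ n) v) = (ν + 2 * n) • (e ^ n) v := by
  induction n with
  | zero => simpa using hv
  | succ n ih =>
    rw [pow_succ', Module.End.mul_apply, apply_e he ih]
    congr 1
    push_cast
    ring

theorem apply_pow_f (hf : h * f - f * h = (-2 : ℝ) • f) {ν : ℝ} {v : V} (hv : h v = ν • v) (n : ℕ) :
    h ((f ^ n) v) = (ν - 2 * n) • (f ^ n) v := by
  induction n with
  | zero => simpa using hv
  | succ n ih =>
    rw [pow_succ', Module.End.mul_apply, apply_f hf ih]
    congr 1
    push_cast
    ring

theorem casimir_apply {ν : ℝ} {v : V} (hv : h v = ν • v) :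
    casimir e f h v = ((ν + 1) ^ 2) • v + (4 : ℝ) • f (e v) := by
  simp only [casimir, LinearMap.add_apply, Module.End.mul_apply, LinearMap.smul_apply,
    Module.End.one_apply, hv, map_add, map_smul]
  module

theorem casimir_apply' (hef : e * f - f * e = h) {ν : ℝ} {v : V} (hv : h v = ν • v) :
    casimir e f h v = ((ν - 1) ^ 2) • v + (4 : ℝ) • e (f v) := by
  have := LinearMap.congr_fun hef v
  simp only [LinearMap.sub_apply, Module.End.mul_apply, hv, sub_eq_iff_eq_add] at this
  rw [casimir_apply hv, this]
  module

theorem commute_casimir_e (he : h * e - e * h = (2 : ℝ) • e) (hef : e * f - f * e = h) :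
    Commute (casimir e f h) e := by
  have he' : h * e = e * h + (e + e) := by rw [← two_smul ℝ e, ← he]; abel
  have hef' : e * f = f * e + h := by rw [← hef]; abel
  rw [Commute, SemiconjBy, casimir, four_smul]
  linear_combination (norm := noncomm_ring)
    (h + 1) * he' + he' * (h + 1) - 2 * he' - 4 * hef' * e

theorem commute_casimir_f (hf : h * f - f * h = (-2 : ℝ) • f) (hef : e * f - f * e = h) :
    Commute (casimir e f h) f := by
  have hf' : h * f = f * h - (f + f) := by
    rw [← two_smul ℝ f, sub_eq_add_neg, ← neg_smul, ← hf]; abel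
  have hef' : e * f = f * e + h := by rw [← hef]; abel
  rw [Commute, SemiconjBy, casimir, four_smul]
  linear_combination (norm := noncomm_ring)
    (h + 1) * hf' + hf' * (h + 1) + 2 * hf' + 4 * f * hef' - 4 * hf'

variable [FiniteDimensional ℝ V]

/-- If `v ≠ 0`, then no `f ^ n v` vanishes: the last nonzero one, of weight `ν - 2n`, would have
Casimir eigenvalue `(ν - 2n - 1)² ≥ (1 - ν)² > c`. So `h` would have infinitely many eigenvalues. -/
theorem eq_zero_of_casimir_apply_eq (hf : h * f - f * h = (-2 : ℝ) • f) (hef : e * f - f * e = h)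
    {ν c : ℝ} (hν : ν < 0) (hc : c < (1 - ν) ^ 2) {v : V} (hv : h v = ν • v)
    (hcv : casimir e f h v = c • v) : v = 0 := by
  by_contra hv0
  have hcn (n : ℕ) : casimir e f h ((f ^ n) v) = c • (f ^ n) v := by
    have := ((commute_casimir_f hf hef).pow_right n).eq
    rw [← Module.End.mul_apply, this, Module.End.mul_apply, hcv, map_smul]
  have hne (n : ℕ) : (f ^ n) v ≠ 0 := by
    induction n with
    | zero => simpa using hv0
    | succ n ih =>
      intro h0
      rw [pow_succ', Module.End.mul_apply] at h0
      have h1 := casimir_apply' (e := e) (f := f) hef (apply_pow_f hf hv n)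
      rw [hcn, h0, map_zero, smul_zero, add_zero] at h1
      have h2 := smul_left_injective ℝ ih h1
      have hn : (0 : ℝ) ≤ n := n.cast_nonneg
      nlinarith
  have hinf : (Set.range fun n : ℕ => ν - 2 * (n : ℝ)).Infinite :=
    Set.infinite_range_of_injective fun a b hab => by simpa using hab
  refine hinf ((Module.End.finite_hasEigenvalue h).subset ?_)
  rintro _ ⟨n, rfl⟩
  exact Module.End.hasEigenvalue_of_hasEigenvector
    ⟨Module.End.mem_eigenspace_iff.mpr (apply_pow_f hf hv n), hne n⟩

theorem eq_zero_of_apply_e_eq_zero (hf : h * f - f * h = (-2 : ℝ) • f) (hef : e * f - f * e = h)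
    {ν : ℝ} (hν : ν < 0) {v : V} (hv : h v = ν • v) (hev : e v = 0) : v = 0 := by
  refine eq_zero_of_casimir_apply_eq hf hef hν (c := (ν + 1) ^ 2) (by nlinarith) hv ?_
  rw [casimir_apply hv, hev, map_zero, smul_zero, add_zero]

/-- If `e ^ (j + 1)` kills `v`, then `e ^ j v` is a Casimir eigenvector with eigenvalue `c`. As the
Casimir operator commutes with `e`, its difference with `c` sends `v` into the kernel of `e ^ j`,
which is zero on this weight space by induction. Then `c < (m + 1)²`, because `j < m`, forces `v =
0`. -/
theorem eq_zero_of_pow_e_apply_eq_zero (he : h * e - e * h = (2 : ℝ) • e)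
    (hf : h * f - f * h = (-2 : ℝ) • f) (hef : e * f - f * e = h)
    {m : ℕ} {j : ℕ} (hj : j ≤ m) {v : V} (hv : h v = (-(m : ℝ)) • v) (hev : (e ^ j) v = 0) :
    v = 0 := by
  induction j generalizing v with
  | zero => simpa using hev
  | succ j ih =>
    set c : ℝ := (-(m : ℝ) + 2 * j + 1) ^ 2 with hc
    have hjm : (j : ℝ) + 1 ≤ m := by exact_mod_cast hj
    have hj0 : (0 : ℝ) ≤ j := j.cast_nonneg
    have hcomm : Commute h (casimir e f h) := by
      have he' : h * e = e * h + (2 : ℝ) • e := by rw [← he]; abel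
      have hf' : h * f = f * h + (-2 : ℝ) • f := by rw [← hf]; abel
      have h2 : Commute h (f * e) := by
        rw [Commute, SemiconjBy, ← mul_assoc, hf', add_mul, mul_assoc, he', mul_add,
          smul_mul_assoc, mul_smul_comm, mul_assoc]
        module
      have h1 : Commute h (h + 1) := (Commute.refl h).add_right (Commute.one_right h)
      exact (h1.mul_right h1).add_right (h2.smul_right _)
    have hu : casimir e f h v - c • v = 0 := by
      refine ih (Nat.le_of_succ_le hj) ?_ ?_
      · rw [map_sub, map_smul, ← Module.End.mul_apply, hcomm.eq, Module.End.mul_apply, hv]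
        simp only [map_smul]
        module
      · have h1 := ((commute_casimir_e he hef).pow_right j).eq
        rw [map_sub, map_smul, ← Module.End.mul_apply, ← h1, Module.End.mul_apply,
          casimir_apply (apply_pow_e he hv j), ← Module.End.mul_apply e, ← pow_succ', hev, map_zero,
          smul_zero, add_zero, sub_self]
    refine eq_zero_of_casimir_apply_eq hf hef (c := c) (by linarith) ?_ hv (sub_eq_zero.mp hu)
    rw [hc]
    nlinarith

end SlTwo

/-- A linear map that is injective on the span of a set of coordinate vectors and maps it to the
span of another set of coordinate vectors. -/
theorem card_le_card_of_injOn_supported {κ : Type*} [Fintype κ] (g : (κ → ℝ) →ₗ[ℝ] (κ → ℝ))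
    (A B : Finset κ) (hmaps : ∀ v : κ → ℝ, (∀ i ∉ A, v i = 0) → ∀ i ∉ B, g v i = 0)
    (hinj : ∀ v : κ → ℝ, (∀ i ∉ A, v i = 0) → g v = 0 → v = 0) : A.card ≤ B.card := by
  classical
  set ext : (A → ℝ) →ₗ[ℝ] (κ → ℝ) := Function.ExtendByZero.linearMap ℝ ((↑) : A → κ) with hext
  have hval (x : A → ℝ) (i : A) : ext x i = x i :=
    Subtype.val_injective.extend_apply _ _ _
  have hsupp (x : A → ℝ) : ∀ i ∉ A, ext x i = 0 := fun i hi =>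
    Function.extend_apply' _ _ _ (by rintro ⟨j, rfl⟩; exact hi j.2)
  set r : (κ → ℝ) →ₗ[ℝ] (B → ℝ) := LinearMap.funLeft ℝ ℝ ((↑) : B → κ) with hr
  have h : Function.Injective (r ∘ₗ g ∘ₗ ext) := by
    rw [← LinearMap.ker_eq_bot, LinearMap.ker_eq_bot']
    intro x hx
    have hg : g (ext x) = 0 := by
      funext i
      by_cases hi : i ∈ B
      · exact congrFun hx ⟨i, hi⟩
      · exact hmaps _ (hsupp x) i hi
    have := hinj _ (hsupp x) hg
    funext i
    rw [← hval x i, this]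
    rfl
  have := LinearMap.finrank_le_finrank_of_injective h
  simpa using this

/-! ### Lefschetz properties of sets of roots -/

namespace WengZeta

open RootPairing GeckConstruction Matrix

section Irreducible

attribute [local instance] LieRing.ofAssociativeRing

variable {ι M N : Type*} [Fintype ι] [AddCommGroup M] [Module ℝ M] [AddCommGroup N] [Module ℝ N]
  {Q : RootPairing ι ℝ M N} [Q.IsCrystallographic] {b : Q.Base} {J : Finset b.support}
  {c : b.support → ℝ} {μ : ι → ℤ}

/-- The element `∑ c_j h_j` acts on the root vector of `i` by `μ i`. As `μ = 2` on `J`, it completes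
`∑ e_j` and `∑ c_j f_j` to an `𝔰𝔩₂`-triple. -/
theorem sum_h_mul_sum_e_sub (hμ : ∀ i, (μ i : ℝ) = ∑ j ∈ J, c j * Q.pairing i j)
    (hJ : ∀ j ∈ J, μ j = 2) :
    (∑ j ∈ J, c j • h j) * (∑ j ∈ J, e j) - (∑ j ∈ J, e j) * (∑ j ∈ J, c j • h j) =
      (2 : ℝ) • ∑ j ∈ J, e j := by
  have h1 (i j : b.support) : (c j • h j) * e i - e i * (c j • h j) =
      (c j * Q.pairing i j) • e i := by
    have := lie_h_e i j
    rw [Ring.lie_def] at this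
    rw [smul_mul_assoc, mul_smul_comm, ← smul_sub, this, ← Int.cast_smul_eq_zsmul ℝ, smul_smul]
    congr 2
    exact b.algebraMap_cartanMatrixIn_apply ℤ i j
  rw [Finset.sum_mul_sum, Finset.sum_mul_sum, Finset.sum_comm, ← Finset.sum_sub_distrib,
    Finset.smul_sum]
  refine Finset.sum_congr rfl fun i hi => ?_
  rw [← Finset.sum_sub_distrib, Finset.sum_congr rfl fun j _ => h1 i j, ← Finset.sum_smul, ← hμ,
    hJ i hi, Int.cast_two]

theorem sum_h_mul_sum_f_sub (hμ : ∀ i, (μ i : ℝ) = ∑ j ∈ J, c j * Q.pairing i j)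
    (hJ : ∀ j ∈ J, μ j = 2) :
    (∑ j ∈ J, c j • h j) * (∑ j ∈ J, c j • f j) - (∑ j ∈ J, c j • f j) * (∑ j ∈ J, c j • h j) =
      (-2 : ℝ) • ∑ j ∈ J, c j • f j := by
  have h1 (i j : b.support) : (c j • h j) * (c i • f i) - (c i • f i) * (c j • h j) =
      (c j * Q.pairing i j) • -(c i • f i) := by
    have := lie_h_f i j
    rw [Ring.lie_def] at this
    rw [smul_mul_smul_comm, smul_mul_smul_comm, mul_comm (c i), ← smul_sub, this,
      ← Int.cast_smul_eq_zsmul ℝ, smul_neg, smul_smul, smul_smul, ← neg_smul,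
      ← b.algebraMap_cartanMatrixIn_apply ℤ i j]
    congr 1
    simp
    ring
  rw [Finset.sum_mul_sum, Finset.sum_mul_sum, Finset.sum_comm, ← Finset.sum_sub_distrib,
    Finset.smul_sum]
  refine Finset.sum_congr rfl fun i hi => ?_
  rw [← Finset.sum_sub_distrib, Finset.sum_congr rfl fun j _ => h1 i j, ← Finset.sum_smul, ← hμ,
    hJ i hi, Int.cast_two, smul_neg, neg_smul]

theorem sum_e_mul_sum_f_sub [Q.IsReduced] [Q.IsIrreducible] :
    (∑ j ∈ J, e j) * (∑ j ∈ J, c j • f j) - (∑ j ∈ J, c j • f j) * (∑ j ∈ J, e j) =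
      ∑ j ∈ J, c j • h j := by
  classical
  have h1 (i j : b.support) : e i * (c j • f j) - (c j • f j) * e i =
      if i = j then c j • h j else 0 := by
    rw [smul_mul_assoc, mul_smul_comm, ← smul_sub, ← Ring.lie_def]
    split_ifs with hij
    · rw [hij, lie_e_f_same]
    · rw [lie_e_f_ne hij, smul_zero]
  rw [Finset.sum_mul_sum, Finset.sum_mul_sum, Finset.sum_comm, ← Finset.sum_sub_distrib]
  refine Finset.sum_congr rfl fun i hi => ?_
  rw [← Finset.sum_sub_distrib, Finset.sum_congr rfl fun j _ => h1 j i, Finset.sum_ite_eq' J i,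
    if_pos hi]

theorem sum_h_mulVec_inr [DecidableEq ι] (hμ : ∀ i, (μ i : ℝ) = ∑ j ∈ J, c j * Q.pairing i j)
    (v : b.support ⊕ ι → ℝ) (x : b.support ⊕ ι) :
    ((∑ j ∈ J, c j • h j) *ᵥ v) x =
      Sum.elim (0 : b.support → ℝ) (fun i => (μ i : ℝ)) x * v x := by
  have : (∑ j ∈ J, c j • h j : Matrix (b.support ⊕ ι) (b.support ⊕ ι) ℝ) =
      diagonal (Sum.elim 0 fun i => (μ i : ℝ)) := by
    ext x y
    rw [Matrix.sum_apply]
    simp only [h_eq_diagonal, Matrix.smul_apply, diagonal_apply]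
    split_ifs with hxy
    · rcases x with x | x
      · simp
      · simp [hμ, ← Q.algebraMap_pairingIn ℤ]
    · simp
  rw [this, mulVec_diagonal]

/-- A root vector could leave `I` in two ways under `e_j`: into the Cartan part, only from the root
opposite to `j`, or to the sum with the root `j`. -/
theorem sum_e_mulVec_eq_zero [DecidableEq ι] (hμ : ∀ i, (μ i : ℝ) = ∑ j ∈ J, c j * Q.pairing i j)
    (hJ : ∀ j ∈ J, μ j = 2) {I : Finset ι} (hneg : ∀ j ∈ J, Q.reflectionPerm j j ∉ I)
    (hadd : ∀ i ∈ I, ∀ j ∈ J, ∀ k, Q.root k = Q.root i + Q.root j → k ∈ I) (n : ℤ)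
    {v : b.support ⊕ ι → ℝ} (hv : ∀ x ∉ {i ∈ I | μ i = n}.map .inr, v x = 0) :
    ∀ x ∉ {i ∈ I | μ i = n + 2}.map .inr, ((∑ j ∈ J, e j) *ᵥ v) x = 0 := by
  intro x hx
  rw [mulVec, dotProduct]
  refine Finset.sum_eq_zero fun y _ => ?_
  by_cases hy : y ∈ {i ∈ I | μ i = n}.map .inr
  swap
  · rw [hv y hy, mul_zero]
  obtain ⟨i, hi, rfl⟩ := Finset.mem_map.mp hy
  rw [Finset.mem_filter] at hi
  rw [Matrix.sum_apply, Finset.sum_eq_zero, zero_mul]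
  intro j hj
  rcases x with k | k
  · simp only [e, Function.Embedding.inr_apply, fromBlocks_apply₁₂, of_apply]
    rw [if_neg]
    rintro ⟨-, rfl⟩
    exact hneg j hj hi.1
  · simp only [e, Function.Embedding.inr_apply, fromBlocks_apply₂₂, of_apply]
    rw [if_neg]
    intro hk
    rw [add_comm] at hk
    refine hx (Finset.mem_map.mpr ⟨k, Finset.mem_filter.mpr ⟨hadd i hi.1 j hj k hk, ?_⟩, rfl⟩)
    have h1 : (μ k : ℝ) = μ i + μ j := by
      rw [hμ, hμ, hμ, ← Finset.sum_add_distrib]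
      refine Finset.sum_congr rfl fun l _ => ?_
      rw [Q.pairing_eq_add_of_root_eq_add hk, mul_add]
    rw [hJ j hj, hi.2] at h1
    exact_mod_cast h1

/-- The multiplicity of a weight is the dimension of a space of coordinate vectors. Stability under
`e` is enough, since injectivity is inherited from the whole representation. -/
theorem isLefschetz_map_of_isIrreducible [Q.IsReduced] [Q.IsIrreducible]
    (hμ : ∀ i, (μ i : ℝ) = ∑ j ∈ J, c j * Q.pairing i j) (hJ : ∀ j ∈ J, μ j = 2) {I : Finset ι}
    (hneg : ∀ j ∈ J, Q.reflectionPerm j j ∉ I)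
    (hadd : ∀ i ∈ I, ∀ j ∈ J, ∀ k, Q.root k = Q.root i + Q.root j → k ∈ I) :
    IsLefschetz (I.val.map μ) := by
  classical
  set A : ℤ → Finset (b.support ⊕ ι) := fun n => {i ∈ I | μ i = n}.map .inr with hA
  have hcount (n : ℤ) : (I.val.map μ).count n = (A n).card := by
    rw [Multiset.count_map, hA, Finset.card_map, Finset.card_def, Finset.filter_val]
    simp only [eq_comm]
  let φ : Matrix (b.support ⊕ ι) (b.support ⊕ ι) ℝ ≃ₐ[ℝ] _ := toLinAlgEquiv'
  set E := φ (∑ j ∈ J, e j) with hE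
  set F := φ (∑ j ∈ J, c j • f j) with hF
  set H := φ (∑ j ∈ J, c j • h j) with hH
  have he : H * E - E * H = (2 : ℝ) • E := by
    rw [← map_mul, ← map_mul, ← map_sub, sum_h_mul_sum_e_sub hμ hJ, map_smul]
  have hf : H * F - F * H = (-2 : ℝ) • F := by
    rw [← map_mul, ← map_mul, ← map_sub, sum_h_mul_sum_f_sub hμ hJ, map_smul]
  have hef : E * F - F * E = H := by
    rw [← map_mul, ← map_mul, ← map_sub, sum_e_mul_sum_f_sub]
  have hmaps (n : ℤ) (v : b.support ⊕ ι → ℝ) (hv : ∀ x ∉ A n, v x = 0) :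
      ∀ x ∉ A (n + 2), E v x = 0 :=
    sum_e_mulVec_eq_zero hμ hJ hneg hadd n hv
  have hmaps' (n : ℤ) (m : ℕ) (v : b.support ⊕ ι → ℝ) (hv : ∀ x ∉ A n, v x = 0) :
      ∀ x ∉ A (n + 2 * m), (E ^ m) v x = 0 := by
    induction m with
    | zero => simpa using hv
    | succ m ih =>
      rw [pow_succ', Module.End.mul_apply]
      convert hmaps _ _ ih using 4
      congr 1
      push_cast
      ring
  have hwt (n : ℤ) (v : b.support ⊕ ι → ℝ) (hv : ∀ x ∉ A n, v x = 0) : H v = (n : ℝ) • v := by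
    funext x
    refine (sum_h_mulVec_inr hμ v x).trans ?_
    by_cases hx : x ∈ A n
    · obtain ⟨i, hi, rfl⟩ := Finset.mem_map.mp hx
      simp [(Finset.mem_filter.mp hi).2]
    · simp [hv x hx]
  constructor
  · intro n hn
    rw [hcount, hcount]
    refine card_le_card_of_injOn_supported E _ _ (hmaps n) fun v hv hv0 => ?_
    exact SlTwo.eq_zero_of_apply_e_eq_zero hf hef (ν := n) (by exact_mod_cast hn) (hwt n v hv) hv0
  · intro n hn
    obtain ⟨m, rfl⟩ : ∃ m : ℕ, n = -(m : ℤ) := ⟨n.natAbs, by lia⟩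
    rw [hcount, hcount]
    refine card_le_card_of_injOn_supported (E ^ m) _ _ (fun v hv => ?_) fun v hv hv0 => ?_
    · convert hmaps' _ m v hv using 4
      congr 1
      ring
    · exact SlTwo.eq_zero_of_pow_e_apply_eq_zero he hf hef le_rfl
        (by simpa using hwt _ v hv) hv0

end Irreducible

end WengZeta

/-! ### Irreducible components of root systems -/

namespace WengZeta

open RootPairing Set Submodule

section Component

variable {ι M N : Type*} [AddCommGroup M] [Module ℝ M] [AddCommGroup N] [Module ℝ N]
  (P : RootPairing ι ℝ M N)

/-- The set of roots connected to a given one by a chain of non-orthogonal roots. -/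
def component (p : ι) : Set ι := {k | Relation.ReflTransGen (fun i j => P.pairing i j ≠ 0) p k}

variable {P}

theorem mem_component_self (p : ι) : p ∈ component P p := Relation.ReflTransGen.refl

theorem mem_component_of_pairing_ne_zero {p i j : ι} (hi : i ∈ component P p)
    (h : P.pairing i j ≠ 0) : j ∈ component P p := Relation.ReflTransGen.tail hi h

theorem mem_component_of_pairing_ne_zero' {p i j : ι} (hi : i ∈ component P p)
    (h : P.pairing j i ≠ 0) : j ∈ component P p :=
  mem_component_of_pairing_ne_zero hi fun h0 => h (P.pairing_eq_zero_iff'.mp h0)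

theorem reflectionPerm_mem_component {p i j : ι} (hj : j ∈ component P p) :
    P.reflectionPerm i j ∈ component P p := by
  by_cases h : P.pairing j i = 0
  · rwa [P.reflectionPerm_eq_of_pairing_eq_zero h]
  · refine mem_component_of_pairing_ne_zero' (mem_component_of_pairing_ne_zero hj h) ?_
    rwa [← P.pairing_reflectionPerm, P.pairing_reflectionPerm_self_right, neg_ne_zero]

theorem mem_component_iff_of_pairing_ne_zero {p i j : ι} (h : P.pairing i j ≠ 0) :
    i ∈ component P p ↔ j ∈ component P p :=
  ⟨fun hi => mem_component_of_pairing_ne_zero hi h,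
    fun hj => mem_component_of_pairing_ne_zero' hj h⟩

/-- If `i` is orthogonal to `k = i + j`, then `j` is orthogonal to neither and links them. -/
theorem mem_component_iff_of_root_eq_add {p i j k : ι} (hk : P.root k = P.root i + P.root j) :
    k ∈ component P p ↔ i ∈ component P p := by
  have h (l : ι) : P.pairing k l = P.pairing i l + P.pairing j l :=
    P.pairing_eq_add_of_root_eq_add hk
  by_cases hik : P.pairing i k = 0
  · have h1 : P.pairing j k ≠ 0 := by
      have := h k
      rw [hik, P.pairing_same, zero_add] at this
      rw [← this]
      exact two_ne_zero
    have h2 : P.pairing j i ≠ 0 := by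
      have := h i
      rw [P.pairing_eq_zero_iff'.mp hik, P.pairing_same] at this
      intro h0
      rw [h0, add_zero] at this
      exact two_ne_zero this.symm
    rw [← mem_component_iff_of_pairing_ne_zero h1, mem_component_iff_of_pairing_ne_zero h2]
  · exact (mem_component_iff_of_pairing_ne_zero hik).symm

theorem component_flip (p : ι) : component P.flip p = component P p := by
  have : (fun i j => P.flip.pairing i j ≠ 0) = fun i j => P.pairing i j ≠ 0 := by
    funext i j
    rw [P.pairing_flip, ne_eq, P.pairing_eq_zero_iff']
  rw [component, component, this]

/-- The restriction of a root pairing to a set of roots stable under the corresponding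
reflections. -/
def restrictIndex (P : RootPairing ι ℝ M N) (s : Set ι)
    (hs : ∀ i ∈ s, ∀ j, P.reflectionPerm i j ∈ s ↔ j ∈ s) : RootPairing s ℝ M N where
  toLinearMap := P.toLinearMap
  root := (Function.Embedding.subtype _).trans P.root
  coroot := (Function.Embedding.subtype _).trans P.coroot
  root_coroot_two i := P.root_coroot_two i
  reflectionPerm i := Equiv.Perm.subtypePerm (P.reflectionPerm i) (hs i i.2)
  reflectionPerm_root i j := P.reflectionPerm_root i j
  reflectionPerm_coroot i j := P.reflectionPerm_coroot i j

theorem reflectionPerm_mem_component_iff {p i j : ι} :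
    P.reflectionPerm i j ∈ component P p ↔ j ∈ component P p := by
  refine ⟨fun h => ?_, reflectionPerm_mem_component⟩
  simpa using reflectionPerm_mem_component (i := i) h

variable (P)

/-- The root pairing, on the same modules, consisting of the roots connected to a given one. -/
def componentPairing (p : ι) : RootPairing (component P p) ℝ M N :=
  restrictIndex P (component P p) fun _ _ _ => reflectionPerm_mem_component_iff

variable [Finite ι]

instance (p : ι) : (componentPairing P p).IsBalanced := by
  have := Fintype.ofFinite (component P p)
  infer_instance

/-- The irreducible component of a root pairing containing a given root. -/
def componentSystem (p : ι) : RootPairing (component P p) ℝ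
    (span ℝ (range (componentPairing P p).root)) (span ℝ (range (componentPairing P p).coroot)) :=
  (componentPairing P p).restrictScalars' ℝ

variable (p : ι)

instance : (componentSystem P p).IsRootSystem :=
  inferInstanceAs ((componentPairing P p).restrictScalars' ℝ).IsRootSystem

theorem componentSystem_pairing (i j : component P p) :
    (componentSystem P p).pairing i j = P.pairing i j :=
  (componentPairing P p).restrictScalars_pairing ℝ i j

instance [P.IsCrystallographic] : (componentSystem P p).IsCrystallographic where
  exists_value i j := by
    rw [componentSystem_pairing]
    exact P.exists_value i j

instance [P.IsReduced] : (componentSystem P p).IsReduced where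
  eq_or_eq_neg i j h := by
    have h1 : ¬ LinearIndependent ℝ ![P.root i, P.root j] := fun h2 =>
      h (LinearIndependent.pair_iff.mpr fun s t hst =>
        LinearIndependent.pair_iff.mp h2 s t (congrArg Subtype.val hst))
    rcases IsReduced.eq_or_eq_neg _ _ h1 with h2 | h2
    · exact Or.inl (Subtype.ext h2)
    · exact Or.inr (Subtype.ext h2)

instance : (componentSystem P p).IsIrreducible := by
  have : Nontrivial (span ℝ (range (componentPairing P p).root)) :=
    ⟨(componentSystem P p).root ⟨p, mem_component_self p⟩, 0, (componentSystem P p).ne_zero _⟩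
  refine IsIrreducible.mk' _ fun q hq hq0 => ?_
  set Q : (componentSystem P p).invtRootSubmodule :=
    ⟨q, (mem_invtRootSubmodule_iff _).mpr hq⟩
  -- An invariant subspace without roots is killed by all coroots, hence zero.
  have h1 : ∃ k, (componentSystem P p).root k ∈ q := by
    by_contra! h
    refine hq0 ((Submodule.eq_bot_iff q).mpr fun x hx => ?_)
    rw [eq_zero_iff_forall_coroot'_eq_zero (P := componentSystem P p)]
    exact fun i => invtRootSubmodule.le_ker_coroot' Q (h i) hx
  have h2 (k l : component P p) (hk : (componentSystem P p).root k ∈ q)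
      (hkl : P.pairing k l ≠ 0) : (componentSystem P p).root l ∈ q := by
    by_contra h
    have := invtRootSubmodule.le_ker_coroot' Q h hk
    rw [LinearMap.mem_ker, root_coroot'_eq_pairing, componentSystem_pairing] at this
    exact hkl this
  have h3 (k : ι) (hk : k ∈ component P p) : (componentSystem P p).root ⟨k, hk⟩ ∈ q ↔
      (componentSystem P p).root ⟨p, mem_component_self p⟩ ∈ q := by
    induction hk with
    | refl => rfl
    | tail hk hkl ih =>
      rw [← ih]
      exact ⟨fun h => h2 _ _ h fun h0 => hkl (P.pairing_eq_zero_iff'.mp h0),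
        fun h => h2 _ _ h hkl⟩
  obtain ⟨k, hk⟩ := h1
  rw [h3] at hk
  rw [← top_le_iff, ← IsRootSystem.span_root_eq_top (P := componentSystem P p), span_le]
  rintro _ ⟨l, rfl⟩
  exact (h3 l l.2).mpr hk

end Component

section Base

variable {ι M N : Type*} [AddCommGroup M] [Module ℝ M] [AddCommGroup N] [Module ℝ N]
  {P : RootPairing ι ℝ M N}

/-- A positive root is built from a simple one by adding simple roots, all partial sums being roots.
Every summand and partial sum of a root in `C` stays in `C`. -/
theorem mem_closure_of_isPos [Finite ι] [P.IsCrystallographic] (b : P.Base) {C : Set ι}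
    (hC : ∀ i j k, P.root k = P.root i + P.root j → (k ∈ C ↔ i ∈ C)) {E : Type*} [AddCommGroup E]
    (v : C → E) (hv : ∀ i j k : C, P.root k = P.root i + P.root j → v k = v i + v j) {i : ι}
    (hi : b.IsPos i) (hiC : i ∈ C) :
    v ⟨i, hiC⟩ ∈ AddSubmonoid.closure (v '' {k | (k : ι) ∈ b.support}) := by
  revert hiC
  refine hi.induction_on_add (p := fun i => ∀ hiC : i ∈ C, v ⟨i, hiC⟩ ∈
    AddSubmonoid.closure (v '' {k | (k : ι) ∈ b.support})) (fun j hj hjC => ?_)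
    fun j k l h ih hk hl => ?_
  · exact AddSubmonoid.subset_closure (mem_image_of_mem v hj)
  · have hj : j ∈ C := (hC j k l h).mp hl
    have hkC : k ∈ C := (hC k j l (by rw [h, add_comm])).mp hl
    rw [hv ⟨j, hj⟩ ⟨k, hkC⟩ ⟨l, hl⟩ h]
    exact add_mem (ih hj) (AddSubmonoid.subset_closure (mem_image_of_mem v hk))

theorem mem_closure_or_neg_mem_closure [Finite ι] [P.IsCrystallographic] (b : P.Base) {C : Set ι}
    (hC : ∀ i j k, P.root k = P.root i + P.root j → (k ∈ C ↔ i ∈ C))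
    (hneg : ∀ i ∈ C, P.reflectionPerm i i ∈ C) {E : Type*} [AddCommGroup E]
    (v : C → E) (hv : ∀ i j k : C, P.root k = P.root i + P.root j → v k = v i + v j)
    (hv' : ∀ i j : C, P.root j = - P.root i → v j = - v i) (i : C) :
    v i ∈ AddSubmonoid.closure (v '' {k | (k : ι) ∈ b.support}) ∨
      -v i ∈ AddSubmonoid.closure (v '' {k | (k : ι) ∈ b.support}) := by
  rcases RootPairing.Base.IsPos.or_neg b i with hi | hi
  · exact Or.inl (mem_closure_of_isPos b hC v hv hi i.2)
  · rw [← hv' i ⟨_, hneg i i.2⟩ (by simp)]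
    exact Or.inr (mem_closure_of_isPos b hC v hv hi _)

open Classical in
theorem coe_subtype_support (s : Finset ι) (C : Set ι) :
    (s.subtype (· ∈ C) : Set C) = {k : C | (k : ι) ∈ s} := by
  ext
  simp

open Classical in
/-- The base of an irreducible component consisting of the simple roots that belong to it. -/
def componentBase [Finite ι] [P.IsCrystallographic] (b : P.Base) (p : ι) : (componentSystem P p).Base where
  support := b.support.subtype (· ∈ component P p)
  linearIndepOn_root := by
    rw [coe_subtype_support]
    exact LinearIndependent.of_comp (Submodule.subtype _) (LinearIndependent.comp
      b.linearIndepOn_root (fun i : {k : component P p | (k : ι) ∈ b.support} => ⟨i, i.2⟩)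
      fun i j h => Subtype.ext (Subtype.ext (congrArg (fun x : b.support => (x : ι)) h)))
  linearIndepOn_coroot := by
    rw [coe_subtype_support]
    exact LinearIndependent.of_comp (Submodule.subtype _) (LinearIndependent.comp
      b.linearIndepOn_coroot (fun i : {k : component P p | (k : ι) ∈ b.support} => ⟨i, i.2⟩)
      fun i j h => Subtype.ext (Subtype.ext (congrArg (fun x : b.support => (x : ι)) h)))
  root_mem_or_neg_mem i := by
    rw [coe_subtype_support]
    exact mem_closure_or_neg_mem_closure b (fun i j k => mem_component_iff_of_root_eq_add)
      (fun i hi => reflectionPerm_mem_component hi) (componentSystem P p).root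
      (fun i j k h => Subtype.ext h) (fun i j h => Subtype.ext h) i
  coroot_mem_or_neg_mem i := by
    rw [coe_subtype_support]
    refine mem_closure_or_neg_mem_closure b.flip (C := component P p) (fun i j k h => ?_)
      (fun i (hi : i ∈ component P p) => reflectionPerm_mem_component (P := P) hi)
      (componentSystem P p).coroot (fun i j k (h : P.coroot k = P.coroot i + P.coroot j) => ?_)
      (fun i j (h : P.coroot j = -P.coroot i) => ?_) i
    · rw [← component_flip]
      exact mem_component_iff_of_root_eq_add h
    · exact Subtype.ext h
    · exact Subtype.ext h

theorem mem_componentBase_support [Finite ι] [P.IsCrystallographic] {b : P.Base} {p : ι} {i : component P p} :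
    i ∈ (componentBase b p).support ↔ (i : ι) ∈ b.support := by
  simp [componentBase]

end Base

/-- Passing to the component of `p` changes nothing: simple roots outside it pair to zero with its
roots, so they drop out of the sum for `μ`. -/
theorem isLefschetz_map {ι M N : Type*} [Fintype ι] [AddCommGroup M] [Module ℝ M]
    [AddCommGroup N] [Module ℝ N] {Q : RootPairing ι ℝ M N} [Q.IsCrystallographic] [Q.IsReduced]
    {b : Q.Base} {J : Finset ι} (hJb : J ⊆ b.support) {c : ι → ℝ} {μ : ι → ℤ}
    (hμ : ∀ i, (μ i : ℝ) = ∑ j ∈ J, c j * Q.pairing i j) (hJ : ∀ j ∈ J, μ j = 2) {I : Finset ι}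
    {p : ι} (hp : ∀ i ∈ I, i ∈ component Q p)
    (hneg : ∀ j ∈ J, Q.reflectionPerm j j ∉ I)
    (hadd : ∀ i ∈ I, ∀ j ∈ J, ∀ k, Q.root k = Q.root i + Q.root j → k ∈ I) :
    IsLefschetz (I.val.map μ) := by
  classical
  set b' := componentBase b p
  set J' : Finset b'.support := Finset.univ.filter fun j => ((j : component Q p) : ι) ∈ J
  set I' : Finset (component Q p) := I.subtype (· ∈ component Q p)
  have hI : I.val.map μ = I'.val.map (fun i : component Q p => μ i) := by
    have h1 : I = I'.map (Function.Embedding.subtype _) := by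
      rw [Finset.subtype_map, Finset.filter_true_of_mem hp]
    conv_lhs => rw [h1]
    rw [Finset.map_val, Multiset.map_map]
    rfl
  have hmem (i : component Q p) : i ∈ I' ↔ (i : ι) ∈ I := Finset.mem_subtype
  have hmem' (j : b'.support) : j ∈ J' ↔ ((j : component Q p) : ι) ∈ J := by simp [J']
  rw [hI]
  have := Fintype.ofFinite (component Q p)
  refine isLefschetz_map_of_isIrreducible (Q := componentSystem Q p) (b := b') (J := J')
    (c := fun j => c j) ?_ ?_ ?_ ?_
  · intro i
    rw [hμ]
    refine Finset.sum_bij_ne_zero (fun j hj h0 => ⟨⟨j, mem_component_of_pairing_ne_zero i.2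
      (right_ne_zero_of_mul h0)⟩, mem_componentBase_support.mpr (hJb hj)⟩) ?_ ?_ ?_ ?_
    · exact fun j hj h0 => (hmem' _).mpr hj
    · intro j hj h0 k hk h0' h
      simpa using h
    · intro j hj h0
      rw [componentSystem_pairing] at h0
      exact ⟨j, (hmem' j).mp hj, h0, rfl⟩
    · intro j hj h0
      rw [componentSystem_pairing]
  · exact fun j hj => hJ j ((hmem' j).mp hj)
  · exact fun j hj h => hneg j ((hmem' j).mp hj) ((hmem _).mp h)
  · intro i hi j hj k h
    exact (hmem k).mpr (hadd i ((hmem i).mp hi) j ((hmem' j).mp hj) k (congrArg Subtype.val h))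

end WengZeta

/-! ### Root combinatorics of a maximal parabolic subsystem -/

namespace WengZeta

open RootPairing Set Submodule

variable {ι V N : Type*} [AddCommGroup V] [Module ℝ V] [AddCommGroup N] [Module ℝ N]
  {P : RootPairing ι ℝ V N}

theorem coroot_smul_eq_add (w : P.weylGroup) {i j k : ι}
    (h : P.coroot k = P.coroot i + P.coroot j) :
    P.coroot (w • k) = P.coroot (w • i) + P.coroot (w • j) := by
  have hw (i : ι) : (w : P.Aut).coweightMap (P.coroot (w • i)) = P.coroot i := by
    rw [Hom.coroot_coweightMap_apply]
    exact congrArg P.coroot ((w : P.Aut).indexEquiv.symm_apply_apply i)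
  apply (w : P.Aut).bijective_coweightMap.1
  rw [map_add, hw, hw, hw, h]

theorem not_isPos_reflectionPerm_self {b : P.Base} {j : ι} (hj : b.IsPos j) :
    ¬ b.IsPos (P.reflectionPerm j j) := fun h =>
  (Base.IsPos.neg_iff_not b j).mp h hj

theorem isPos_reflectionPerm_iff [Finite ι] [P.IsCrystallographic] [P.IsReduced] (b : P.Base)
    {i j : ι} (hj : j ∈ b.support) (hij : i ≠ j) (hij' : i ≠ P.reflectionPerm j j) :
    b.IsPos (P.reflectionPerm j i) ↔ b.IsPos i := by
  refine ⟨fun h => ?_, fun h => h.reflectionPerm hj hij⟩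
  have := h.reflectionPerm hj fun h' => hij' (by
    rw [← P.reflectionPerm_self j i, h'])
  rwa [P.reflectionPerm_self] at this

/-- Both notions of positivity hold for simple roots and behave alike under negation and under
simple reflections, which generate all roots from the simple ones. -/
theorem isPos_flip_iff [Finite ι] [P.IsCrystallographic] [P.IsReduced] {b : P.Base} {i : ι} :
    b.flip.IsPos i ↔ b.IsPos i := by
  have hneg (i : ι) (h : b.flip.IsPos i ↔ b.IsPos i) :
      b.flip.IsPos (P.reflectionPerm i i) ↔ b.IsPos (P.reflectionPerm i i) :=
    (Base.IsPos.neg_iff_not b.flip i).trans ((not_congr h).trans (Base.IsPos.neg_iff_not b i).symm)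
  refine b.induction_reflect i (p := fun i => b.flip.IsPos i ↔ b.IsPos i) hneg
    (fun j hj => iff_of_true (b.flip.isPos_of_mem_support hj) (b.isPos_of_mem_support hj))
    fun i j h hj => ?_
  by_cases hij : i = j
  · rw [← hij]
    exact hneg i h
  by_cases hij' : i = P.reflectionPerm j j
  · rw [hij', P.reflectionPerm_self]
    exact iff_of_true (b.flip.isPos_of_mem_support hj) (b.isPos_of_mem_support hj)
  · rw [isPos_reflectionPerm_iff b hj hij hij', ← h]
    exact isPos_reflectionPerm_iff b.flip hj hij hij'

/-- The reflection in `j` permutes `S \ {j}` and negates the pairing with `j`, so only the term of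
`j` survives. -/
theorem sum_pairing_eq_two {S : Finset ι} {j : ι} (hj : j ∈ S)
    (hS : ∀ i ∈ S, i ≠ j → P.reflectionPerm j i ∈ S ∧ P.reflectionPerm j i ≠ j) :
    ∑ i ∈ S, P.pairing i j = 2 := by
  classical
  have h : ∑ i ∈ S.erase j, P.pairing i j = ∑ i ∈ S.erase j, -P.pairing i j := by
    refine Finset.sum_nbij' (P.reflectionPerm j) (P.reflectionPerm j) ?_ ?_ ?_ ?_ ?_
    · intro i hi
      rw [Finset.mem_erase] at hi ⊢
      exact (hS i hi.2 hi.1).symm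
    · intro i hi
      rw [Finset.mem_erase] at hi ⊢
      exact (hS i hi.2 hi.1).symm
    · simp
    · simp
    · intro i _
      rw [← P.pairing_reflectionPerm, P.pairing_reflectionPerm_self_right, neg_neg]
  rw [Finset.sum_neg_distrib] at h
  rw [← Finset.add_sum_erase S _ hj, P.pairing_same]
  linarith

section

variable {b : P.Base}

theorem mem_posRoots [Fintype ι] {i : ι} : i ∈ posRoots b ↔ b.IsPos i := by
  simp [posRoots]

theorem coheight_eq_one [Fintype ι] [P.IsCrystallographic] [P.IsReduced] {j : ι}
    (hj : j ∈ b.support) : coheight b j = 1 := by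
  have : ∑ i ∈ posRoots b, P.pairing i j = 2 := by
    refine sum_pairing_eq_two (mem_posRoots.mpr (b.isPos_of_mem_support hj)) fun i hi hij => ?_
    rw [mem_posRoots] at hi ⊢
    refine ⟨hi.reflectionPerm hj hij, fun h => ?_⟩
    have h1 := not_isPos_reflectionPerm_self (b.isPos_of_mem_support hj)
    nth_rw 2 [← h] at h1
    rw [P.reflectionPerm_self] at h1
    exact h1 hi
  simp [coheight, weylVector, this]

variable [P.IsRootSystem] {p : b.support}

theorem mem_leviPosRoots [Fintype ι] {i : ι} : i ∈ leviPosRoots b p ↔ b.IsPos i ∧ level b p i = 0 := by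
  simp [leviPosRoots, mem_posRoots]

theorem mem_nilPosRoots [Fintype ι] {i : ι} : i ∈ nilPosRoots b p ↔ b.IsPos i ∧ level b p i ≠ 0 := by
  simp only [nilPosRoots, Finset.mem_sdiff, mem_posRoots, mem_leviPosRoots]
  tauto

theorem level_eq_add {i j k : ι} (h : P.coroot k = P.coroot i + P.coroot j) :
    level b p k = level b p i + level b p j := by
  rw [level, h, map_add, level, level]

theorem level_self : level b p p = 1 := by
  rw [level, fundamentalWeight_coroot, if_pos rfl]

theorem level_eq_zero {j : ι} (hj : j ∈ b.support) (hjp : j ≠ p) : level b p j = 0 := by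
  have := fundamentalWeight_coroot b p ⟨j, hj⟩
  rwa [if_neg fun h => hjp (congrArg Subtype.val h)] at this

theorem level_reflectionPerm {i j : ι} (hj : level b p j = 0) :
    level b p (P.reflectionPerm j i) = level b p i := by
  rw [level] at hj
  rw [level, P.coroot_reflectionPerm, P.coreflection_apply, map_sub, map_smul, hj, smul_zero,
    sub_zero, level]

/-- A coroot of level zero is a combination of simple coroots other than that of `p`, and
`CoPolarization` maps each coroot to a nonzero multiple of its root. -/
theorem mem_span_of_level_eq_zero [Fintype ι] {i : ι} (hi : level b p i = 0) :
    P.root i ∈ span ℝ (P.root '' (b.support \ {(p : ι)})) := by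
  set S := span ℝ (P.root '' (b.support \ {(p : ι)})) with hS
  have h1 (j : ι) : P.root j ∈ S ↔ P.CoPolarization (P.coroot j) ∈ S := by
    have h := P.corootForm_self_smul_root j
    rw [← S.smul_mem_iff (IsAnisotropic.corootForm_coroot_ne_zero (P := P) j), h,
      ← Nat.cast_smul_eq_nsmul ℝ, S.smul_mem_iff (by norm_num)]
  rw [h1, ← Submodule.mem_comap, ← b.toCoweightBasis.sum_repr (P.coroot i)]
  refine sum_mem fun j _ => ?_
  by_cases hj : j = p
  · have : b.toCoweightBasis.repr (P.coroot i) p = 0 := by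
      rw [← hi, level, fundamentalWeight]
      exact (LinearMap.congr_fun (P.toLinearMap.toPerfPair.apply_symm_apply
        (b.toCoweightBasis.coord p)) (P.coroot i)).symm
    rw [hj, this, zero_smul]
    exact zero_mem _
  · refine Submodule.smul_mem _ _ ?_
    rw [Base.toCoweightBasis_apply, mem_comap, ← h1]
    exact subset_span (mem_image_of_mem _ ⟨j.2, fun h => hj (Subtype.ext h)⟩)

/-- The number `2⟨ρ_p, α^∨⟩`. -/
def leviDegree [Fintype ι] [P.IsCrystallographic] (b : P.Base) (p : b.support) (i : ι) : ℤ :=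
  ∑ k ∈ leviPosRoots b p, P.pairingIn ℤ k i

theorem leviDegree_eq [Fintype ι] [P.IsCrystallographic] (i : ι) :
    (leviDegree b p i : ℝ) = 2 * P.toLinearMap (leviWeylVector b p) (P.coroot i) := by
  have h (k : ι) : (P.pairingIn ℤ k i : ℝ) = P.pairing k i := P.algebraMap_pairingIn ℤ k i
  simp [leviDegree, leviWeylVector, h]

variable [Fintype ι] [P.IsCrystallographic] [P.IsReduced]

theorem level_nonneg {i : ι} (hi : b.IsPos i) : 0 ≤ level b p i := by
  refine (isPos_flip_iff.mpr hi).induction_on_add (p := fun i => 0 ≤ level b p i) (fun j hj => ?_)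
    fun i j k h hi hj => ?_
  · by_cases hjp : j = p
    · rw [hjp, level_self]
      exact zero_le_one
    · rw [level_eq_zero (b := b) hj hjp]
  · rw [level_eq_add h]
    refine add_nonneg hi ?_
    by_cases hjp : j = p
    · rw [hjp, level_self]
      exact zero_le_one
    · rw [level_eq_zero (b := b) hj hjp]

theorem level_pos {i : ι} (hi : i ∈ nilPosRoots b p) : 0 < level b p i :=
  (level_nonneg (mem_nilPosRoots.mp hi).1).lt_of_ne' (mem_nilPosRoots.mp hi).2

theorem mem_component_of_level_ne_zero {i : ι} (hi : b.IsPos i) (hl : level b p i ≠ 0) :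
    i ∈ component P.flip p := by
  revert hl
  refine (isPos_flip_iff.mpr hi).induction_on_add
    (p := fun i => level b p i ≠ 0 → i ∈ component P.flip p) (fun j hj hl => ?_)
    fun i j k h hi hj hl => ?_
  · by_cases hjp : j = p
    · rw [hjp]
      exact mem_component_self _
    · exact (hl (level_eq_zero hj hjp)).elim
  · rw [level_eq_add h] at hl
    by_cases hi0 : level b p i = 0
    · rw [hi0, zero_add] at hl
      have hjp : j = p := by
        by_contra hjp
        exact hl (level_eq_zero hj hjp)
      rw [mem_component_iff_of_root_eq_add (i := j) (j := i) (by rw [h, add_comm]), hjp]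
      exact mem_component_self _
    · rw [mem_component_iff_of_root_eq_add h]
      exact hi hi0

theorem leviWeylVector_coroot {j : ι} (hj : j ∈ b.support) (hjp : j ≠ p) :
    P.toLinearMap (leviWeylVector b p) (P.coroot j) = 1 := by
  have : ∑ i ∈ leviPosRoots b p, P.pairing i j = 2 := by
    have hl := level_eq_zero hj hjp
    refine sum_pairing_eq_two (mem_leviPosRoots.mpr ⟨b.isPos_of_mem_support hj, hl⟩)
      fun i hi hij => ?_
    rw [mem_leviPosRoots] at hi ⊢
    refine ⟨⟨hi.1.reflectionPerm hj hij, (level_reflectionPerm hl).trans hi.2⟩, fun h => ?_⟩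
    have h1 := not_isPos_reflectionPerm_self (b.isPos_of_mem_support hj)
    nth_rw 2 [← h] at h1
    rw [P.reflectionPerm_self] at h1
    exact h1 hi.1
  simp [leviWeylVector, this]

/-- Both `ρ` and `ρ_p` pair to `1` with the simple coroots other than that of `p`; the constant
`c_p` is what makes the pairing with the remaining one agree. -/
theorem weylVector_eq :
    weylVector b = leviWeylVector b p + (cConst b p / 2) • fundamentalWeight b p := by
  have h : P.toLinearMap (weylVector b) =
      P.toLinearMap (leviWeylVector b p + (cConst b p / 2) • fundamentalWeight b p) := by
    refine b.toCoweightBasis.ext fun j => ?_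
    have h1 : P.toLinearMap (weylVector b) (P.coroot j) = 1 := coheight_eq_one j.2
    have h2 : P.toLinearMap (fundamentalWeight b p) (P.coroot j) = level b p j := rfl
    rw [Base.toCoweightBasis_apply, h1, map_add, LinearMap.add_apply, map_smul,
      LinearMap.smul_apply, h2, smul_eq_mul]
    by_cases hjp : (j : ι) = p
    · have h3 : P.toLinearMap (fundamentalWeight b p) (P.coroot p) = 1 := level_self
      rw [hjp, level_self, cConst, map_sub, LinearMap.sub_apply, h3]
      ring
    · rw [level_eq_zero j.2 hjp, leviWeylVector_coroot j.2 hjp]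
      ring
  exact P.toPerfPair.injective h

theorem coheight_eq (i : ι) : coheight b i =
    P.toLinearMap (leviWeylVector b p) (P.coroot i) + cConst b p / 2 * level b p i := by
  rw [coheight, weylVector_eq (p := p), map_add, LinearMap.add_apply, map_smul,
    LinearMap.smul_apply, smul_eq_mul, level]

/-- The weights are values on coroots, so the dual root system is used; `c` gives the coordinates of
`2ρ_p` on `Δ_p`, and nonzero level places `I` in the component of `p`. -/
theorem isLefschetz_leviDegree {w : P.weylGroup} (hw : w ∈ admissible b p) (κ : ℝ) {I : Finset ι}
    (hI : ∀ i, i ∈ I ↔ i ∈ nilPosRoots b p ∧ w • i ∉ posRoots b ∧ level b p i = κ) :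
    IsLefschetz (I.val.map (leviDegree b p)) := by
  classical
  have hspan : (2 : ℝ) • leviWeylVector b p ∈ span ℝ (P.root '' ↑(b.support.erase (p : ι))) := by
    rw [leviWeylVector, smul_smul]
    refine Submodule.smul_mem _ _ (sum_mem fun i hi => ?_)
    rw [Finset.coe_erase]
    exact mem_span_of_level_eq_zero (mem_leviPosRoots.mp hi).2
  obtain ⟨c, hc⟩ := (mem_span_image_finset_iff_exists_fun ℝ).mp hspan
  have hc' : (2 : ℝ) • leviWeylVector b p = ∑ j ∈ b.support.erase (p : ι),
      (if hj : j ∈ b.support.erase (p : ι) then c ⟨j, hj⟩ else 0) • P.root j := by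
    rw [← hc, ← Finset.sum_coe_sort (b.support.erase (p : ι))]
    exact Finset.sum_congr rfl fun j _ => by rw [dif_pos j.2]
  refine isLefschetz_map (Q := P.flip) (b := b.flip) (J := b.support.erase p) 
    (c := fun j => if hj : j ∈ b.support.erase (p : ι) then c ⟨j, hj⟩ else 0) (p := p)
    (Finset.erase_subset _ _) ?_ ?_ ?_ ?_ ?_
  · intro i
    rw [leviDegree_eq, ← smul_eq_mul, ← LinearMap.smul_apply, ← map_smul, hc', map_sum,
      LinearMap.sum_apply]
    simp only [map_smul, LinearMap.smul_apply, smul_eq_mul, P.pairing_flip,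
      P.root_coroot_eq_pairing]
  · intro j hj
    rw [Finset.mem_erase] at hj
    have := leviDegree_eq (b := b) (p := p) j
    rw [leviWeylVector_coroot hj.2 hj.1] at this
    exact_mod_cast this
  · intro i hi
    have := mem_nilPosRoots.mp ((hI i).mp hi).1
    exact mem_component_of_level_ne_zero this.1 this.2
  · intro j hj h
    exact not_isPos_reflectionPerm_self (b.isPos_of_mem_support (Finset.mem_of_mem_erase hj))
      (mem_nilPosRoots.mp ((hI _).mp h).1).1
  · intro i hi j hj k h
    rw [Finset.mem_erase] at hj
    rw [hI] at hi ⊢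
    obtain ⟨hi1, hi2, hi3⟩ := hi
    have hlk : level b p k = level b p i := by
      rw [level_eq_add h, level_eq_zero hj.2 hj.1, add_zero]
    rw [mem_nilPosRoots] at hi1 ⊢
    refine ⟨⟨?_, hlk ▸ hi1.2⟩, ?_, hlk.trans hi3⟩
    · rw [← isPos_flip_iff] at hi1 ⊢
      exact hi1.1.add (b.flip.isPos_of_mem_support hj.2) h
    -- This is where `w ∈ 𝔚_p` enters: `w • i` has height at most `-1` and `w • j` at most `1`, so
    -- their sum, a root of nonzero height, is negative.
    · have hk := b.flip.height_add (coroot_smul_eq_add w h)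
      have h0 := b.flip.height_ne_zero (w • i)
      have hj' : b.flip.height (w • j) ≤ 1 := by
        rcases hw j hj.2 hj.1 with h1 | h1
        · rw [b.flip.height_one_of_mem_support h1]
        · rw [mem_posRoots, ← isPos_flip_iff, Base.isPos_iff] at h1
          lia
      rw [mem_posRoots, ← isPos_flip_iff, Base.isPos_iff] at hi2 ⊢
      lia

end

end WengZeta

/-! ### The quotients -/

namespace WengZeta

open Complex Filter Topology RootPairing

theorem DominatedAt.comp_add {S : Prop} {N D : ℂ → ℂ} {s a : ℂ} (h : DominatedAt S (s + a) N D) :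
    DominatedAt S s (fun z => N (z + a)) fun z => D (z + a) := by
  obtain ⟨H, h1, h2, h3, h4⟩ := h
  refine ⟨fun z => H (z + a), h1.comp_of_eq (f := fun z => z + a) (by fun_prop) rfl, ?_, h3, h4⟩
  have : Tendsto (fun z => z + a) (𝓝 s) (𝓝 (s + a)) := (continuous_add_const a).tendsto s
  exact this.eventually h2

/-- If `N` is a multiple of `D` near `s` by an analytic function, then this function agrees near `s`
with the normal form of the quotient `N / D`. -/
theorem toMeromorphicNFOn_div_eventuallyEq {N D H : ℂ → ℂ} {s : ℂ}
    (hm : MeromorphicOn (fun z => N z / D z) Set.univ) (hH : AnalyticAt ℂ H s)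
    (hN : N =ᶠ[𝓝 s] H * D) (hD : ∀ᶠ z in 𝓝[≠] s, D z ≠ 0) :
    toMeromorphicNFOn (fun z => N z / D z) Set.univ =ᶠ[𝓝 s] H := by
  rw [← MeromorphicNFAt.eventuallyEq_nhdsNE_iff_eventuallyEq_nhds
    (meromorphicNFOn_toMeromorphicNFOn _ _ (Set.mem_univ s)) hH.meromorphicNFAt]
  refine (hm.toMeromorphicNFOn_eq_self_on_nhdsNE (Set.mem_univ s)).trans ?_
  filter_upwards [hD, hN.filter_mono nhdsWithin_le_nhds] with z hz hz'
  rw [hz', Pi.mul_apply, mul_div_cancel_right₀ _ hz]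

variable {ι V N : Type*} [Fintype ι] [AddCommGroup V] [Module ℝ V] [AddCommGroup N] [Module ℝ N]
  {P : RootPairing ι ℝ V N} [P.IsRootSystem]
  {b : P.Base} {p : b.support}

theorem delta_one {i : ι} (hi : i ∈ nilPosRoots b p) : delta b (1 : P.weylGroup) i = 1 := by
  rw [delta, one_smul, if_pos (mem_posRoots.mpr (mem_nilPosRoots.mp hi).1)]

variable [P.IsCrystallographic] [P.IsReduced]

/-- At large real points all arguments of `ξ` have real part at least `1`, so `XDagger` is not
identically zero and its zeros are isolated. -/
theorem eventually_XDagger_ne_zero (s : ℂ) : ∀ᶠ z in 𝓝[≠] s, XDagger b p z ≠ 0 := by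
  have han : AnalyticOnNhd ℂ (XDagger b p) Set.univ := fun z _ =>
    (differentiable_X b p 1).analyticAt z
  refine ((han s (Set.mem_univ s)).eventually_eq_zero_or_eventually_ne_zero).resolve_left
    fun h0 => ?_
  have h := han.eqOn_zero_of_preconnected_of_eventuallyEq_zero isPreconnected_univ
    (Set.mem_univ s) h0
  have hx : ∀ᶠ x : ℝ in atTop, ∀ i ∈ nilPosRoots b p, 0 ≤ level b p i * x + coheight b i := by
    rw [eventually_all_finset]
    intro i hi
    exact ((tendsto_id.const_mul_atTop (level_pos hi)).atTop_add
      tendsto_const_nhds).eventually_ge_atTop 0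
  obtain ⟨x, hx⟩ := hx.exists
  refine Finset.prod_ne_zero_iff.mpr (fun i hi => xi_ne_zero ?_) (h (Set.mem_univ (x : ℂ)))
  rw [delta_one hi]
  simpa using hx i hi

/-- Telescoping needs a common coefficient of `t`, so the product is split by level. One nonempty
level suffices for strictness. -/
theorem dominatedAt_prod_leviDegree {w : P.weylGroup} (hw : w ∈ admissible b p) {A : Finset ι}
    (hA : ∀ i, i ∈ A ↔ i ∈ nilPosRoots b p ∧ w • i ∉ posRoots b) {t : ℂ} (ht : 0 ≤ t.re) :
    DominatedAt (0 < t.re ∧ A.Nonempty) t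
      (∏ i ∈ A, fun t => xi (level b p i * t + (leviDegree b p i : ℂ) / 2))
      (∏ i ∈ A, fun t => xi (level b p i * t + (leviDegree b p i : ℂ) / 2 + 1)) := by
  classical
  rw [← Finset.prod_fiberwise_of_maps_to (t := A.image (level b p))
      (fun i hi => Finset.mem_image_of_mem _ hi),
    ← Finset.prod_fiberwise_of_maps_to (t := A.image (level b p))
      (fun i hi => Finset.mem_image_of_mem _ hi)]
  refine (DominatedAt.finset_prod
    (S := fun κ => 0 < t.re ∧ (A.filter fun i => level b p i = κ).Nonempty) fun κ hκ => ?_).mono ?_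
  · obtain ⟨i, hi, rfl⟩ := Finset.mem_image.mp hκ
    have key := dominatedAt_prod_xi (isLefschetz_leviDegree hw (level b p i)
      (I := A.filter fun k => level b p k = level b p i)
      fun k => by rw [Finset.mem_filter, hA, and_assoc]) (level_pos ((hA i).mp hi).1) ht
    convert key using 1
    · refine Finset.prod_congr rfl fun k hk => ?_
      rw [(Finset.mem_filter.mp hk).2]
    · refine Finset.prod_congr rfl fun k hk => ?_
      rw [(Finset.mem_filter.mp hk).2]
  · rintro ⟨h, i, hi⟩
    exact ⟨level b p i, Finset.mem_image_of_mem _ hi, h, i, Finset.mem_filter.mpr ⟨hi, rfl⟩⟩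

theorem level_mul_add_coheight (i : ι) (s : ℂ) : (level b p i : ℂ) * s + (coheight b i : ℂ) =
    level b p i * (s + (cConst b p / 2 : ℝ)) + (leviDegree b p i : ℂ) / 2 := by
  have h : (leviDegree b p i : ℂ) =
      ((2 * P.toLinearMap (leviWeylVector b p) (P.coroot i) : ℝ) : ℂ) := by
    rw [← leviDegree_eq]
    simp
  rw [coheight_eq (p := p), h]
  push_cast
  ring

/-- The roots that `w` keeps positive give the same factor `F` in both functions. It is carried
along rather than divided out, so its zeros do no harm. -/
theorem dominatedAt_X {w : P.weylGroup} (hw : w ∈ admissible b p) {s : ℂ}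
    (hs : -(cConst b p) / 2 ≤ s.re) :
    DominatedAt (-(cConst b p) / 2 < s.re ∧ len b p w ≠ 0) s (X b p w) (XDagger b p) := by
  classical
  set A := {i ∈ nilPosRoots b p | w • i ∉ posRoots b} with hA
  set B := {i ∈ nilPosRoots b p | ¬ w • i ∉ posRoots b} with hB
  set F : ℂ → ℂ := fun s => ∏ i ∈ B, xi (level b p i * s + coheight b i + 1) with hF
  have hre : (s + (cConst b p / 2 : ℝ)).re = s.re + cConst b p / 2 := by simp
  have key := ((dominatedAt_prod_leviDegree hw (A := A) (fun i => by rw [hA, Finset.mem_filter])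
    (t := s + (cConst b p / 2 : ℝ)) (by rw [hre]; linarith)).comp_add).mul_left F
  have e1 : X b p w = F * fun z => (∏ i ∈ A, fun t =>
      xi (level b p i * t + (leviDegree b p i : ℂ) / 2)) (z + (cConst b p / 2 : ℝ)) := by
    funext z
    rw [X, ← Finset.prod_filter_mul_prod_filter_not _ (fun i => w • i ∉ posRoots b), mul_comm,
      Pi.mul_apply, Finset.prod_apply]
    congr 1
    · refine Finset.prod_congr rfl fun i hi => ?_
      have : delta b w i = 1 := if_pos (not_not.mp (Finset.mem_filter.mp hi).2)
      rw [this, Nat.cast_one]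
    · refine Finset.prod_congr rfl fun i hi => ?_
      have : delta b w i = 0 := if_neg (Finset.mem_filter.mp hi).2
      rw [this, Nat.cast_zero, add_zero, level_mul_add_coheight]
  have e2 : XDagger b p = F * fun z => (∏ i ∈ A, fun t =>
      xi (level b p i * t + (leviDegree b p i : ℂ) / 2 + 1)) (z + (cConst b p / 2 : ℝ)) := by
    funext z
    rw [XDagger, X, ← Finset.prod_filter_mul_prod_filter_not _ (fun i => w • i ∉ posRoots b),
      mul_comm, Pi.mul_apply, Finset.prod_apply]
    congr 1
    · refine Finset.prod_congr rfl fun i hi => ?_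
      rw [delta_one (Finset.mem_filter.mp hi).1, Nat.cast_one]
    · refine Finset.prod_congr rfl fun i hi => ?_
      rw [delta_one (Finset.mem_filter.mp hi).1, Nat.cast_one, level_mul_add_coheight]
  rw [e1, e2]
  refine key.mono fun h => ⟨by rw [hre]; linarith [h.1], ?_⟩
  have hcard : len b p w = A.card := by
    rw [hA, len]
  rw [← Finset.card_ne_zero, ← hcard]
  exact h.2

end WengZeta

theorem proposition6p6 {ι V N : Type*} [Fintype ι]
    [AddCommGroup V] [Module ℝ V] [AddCommGroup N] [Module ℝ N]
    (P : RootPairing ι ℝ V N) [P.IsRootSystem] [P.IsCrystallographic] [P.IsReduced]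
    (b : P.Base) (p : b.support) (w : P.weylGroup)
    (hw : w ∈ WengZeta.admissible b p \ WengZeta.admissibleDagger b p) :
    AnalyticOnNhd ℂ (WengZeta.ratio b p w) {s : ℂ | -(WengZeta.cConst b p) / 2 ≤ s.re} ∧
    (∀ s : ℂ, -(WengZeta.cConst b p) / 2 < s.re → ‖WengZeta.ratio b p w s‖ < 1) ∧
    (∀ s : ℂ, s.re = -(WengZeta.cConst b p) / 2 → ‖WengZeta.ratio b p w s‖ ≤ 1) := by
  have hlen : WengZeta.len b p w ≠ 0 := fun h => hw.2 ⟨hw.1, h⟩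
  have key (s : ℂ) (hs : -(WengZeta.cConst b p) / 2 ≤ s.re) :
      AnalyticAt ℂ (WengZeta.ratio b p w) s ∧ ‖WengZeta.ratio b p w s‖ ≤ 1 ∧
        (-(WengZeta.cConst b p) / 2 < s.re → ‖WengZeta.ratio b p w s‖ < 1) := by
    obtain ⟨H, h1, h2, h3, h4⟩ := WengZeta.dominatedAt_X hw.1 hs
    have h5 : WengZeta.ratio b p w =ᶠ[nhds s] H := WengZeta.toMeromorphicNFOn_div_eventuallyEq
      (WengZeta.meromorphicOn_quotient b p w) h1 h2 (WengZeta.eventually_XDagger_ne_zero s)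
    rw [h5.eq_of_nhds]
    exact ⟨h1.congr h5.symm, h3, fun h => h4 ⟨h, hlen⟩⟩
  exact ⟨fun s hs => (key s hs).1, fun s hs => (key s hs.le).2.2 hs,
    fun s hs => (key s hs.ge).2.1⟩

end
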